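/- **Setting.** For each sample size $n$ let $y_t=\sum_{j=1}^{p}\beta_jx_{tj}+\varepsilon_t$ and $x_{tj}=\lambda_j^Tf_t+e_{tj}$ $(1\le t\le n,\ 1\le j\le p)$, with $p=p_n$, non-random $\beta_j\in\mathbb R$ and $\lambda_j\in\mathbb R^r$, and random $f_t\in\mathbb R^r$, $e_{tj}$, $\varepsilon_t\in\mathbb{R}$ (all of these may depend on $n$; $r$ is fixed). Put $X=(x_{tj})$, $E=(e_{tj})$, $F=(f_1,\dots,f_n)^T$, $\Lambda=(\lambda_1,\dots,\lambda_p)^T$. Let $J=J_n\subset\{1,\dots,p\}$ be a non-random set of size $m=m_n$, and let $X_J$, $E_J$ be the columns with index in $J$. $\|\cdot\|$ is the Frobenius norm on matrices and the Euclidean norm on vectors. $M$ is a constant that does not depend on $n$. **Assumptions**, for all $n$ (with every expectation below finite): - A. $p\ge cn$ for some $c>0$ and all large $n$; $m^2/n\to0$; $\sum_j|\beta_j|\le M$. - B1. $E\|f_t\|^4<\infty$; $\frac1nF^TF\to\Sigma_F$ in probability, $\Sigma_F$ positive definite. - B2. $\|\lambda_i\|\le\bar\lambda<\infty$; $\|\frac1p\Lambda^T\Lambda-\Sigma_\Lambda\|\to0$,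 $\Sigma_\Lambda$ positive definite. - B3. (1) $Ee_{ti}=0$, $E|e_{ti}|^8\le M$. (2) With $\gamma(s,t)=E(p^{-1}\sum_ie_{si}e_{ti})$: $|\gamma(s,s)|\le M$ and $n^{-1}\sum_{s,t}|\gamma(s,t)|\le M$. (3) There are $\tau_{ij}$ with $|E(e_{ti}e_{tj})|\le|\tau_{ij}|$ for all $t$ and $p^{-1}\sum_{i,j}|\tau_{ij}|\le M$. (4) $(np)^{-1}\sum_{i,j,t,s}|E(e_{ti}e_{sj})|\le M$. (5) $E|p^{-1/2}\sum_i(e_{si}e_{ti}-E(e_{si}e_{ti}))|^4\le M$ for all $s,t$. - B4. $E\big(\frac1p\sum_i\|\frac1{\sqrt n}\sum_tf_te_{ti}\|^2\big)\le M$. - C1. $\|\frac1nE_J^TE_J-G_J\|\to0$ in probability for non-random positive definite matrices $G_J=G_{J_n}$. - C2. $E\big(\frac1m\sum_{j\in J}\|\frac1{\sqrt n}\sum_tf_te_{tj}\|^2\big)\le M$. - C3. $E\big(\frac1m\sum_{j\in J}(\frac1{\sqrt n}\sum_t\varepsilon_te_{tj})^2\big)\le M$. - C4. For every $i\notin J$,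 $E\big(\frac1m\sum_{j\in J}(\frac1{\sqrt n}\sum_te_{ti}e_{tj})^2\big)\le M$. **Estimated factors.** Fix $k_{\max}\ge r\ge1$. For $1\le k\le k_{\max}$ (and $n$ so large that $p\ge k_{\max}$) let $\bar\Lambda^k\in\mathbb R^{p\times k}$ have as columns $\sqrt p$ times orthonormal eigenvectors for the $k$ largest eigenvalues of $X^TX$ (any choice), $\bar F^k=X\bar\Lambda^k/p$ and $\hat F^k=\bar F^k\big((\bar F^k)^T\bar F^k/n\big)^{1/2}$. Let $V(k)=\min_{L\in\mathbb R^{p\times k}}\|X-\hat F^kL^T\|^2$ and let $\hat k$ be any minimizer over $1\le k\le k_{\max}$ of $\log V(k)+k\frac{n+p}{np}\log\frac{np}{n+p}$ (with $\log 0=-\infty$). Let $\tilde X_J^{(k)}=(I-P_{\hat F^k})X_J$ with $P_{\hat F}=\hat F(\hat F^T\hat F)^{-1}\hat F^T$, and let $\hat F=\hat F^{\hat k}$ and $\tilde X_J=\tilde X_J^{(\hat k)}$ be the estimates with the selected number of factors. **Theorem 3.** Under these assumptions: 1. With the factor estimate of the correct rank, $\hat F=\hat F^{r}$, one has $\|\frac1n\tilde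 X_J^T\tilde X_J-G_J\|\to0$ in probability as $n\to\infty$. If moreover the smallest eigenvalue of $G_J$ is at least some $c>0$ for all large $n$ (which is automatic when $J$ and $G_J$ do not depend on $n$), then $\frac1n\tilde X_J^T\tilde X_J$ is invertible with probability tending to $1$ and its inverse is $O_p(1)$ in spectral norm. 2. The same holds for $\hat F=\hat F^{\hat k}$ given $\hat k=r$: for every $\delta>0$, $P\big(\hat k=r,\ \|\frac1n\tilde X_J^T\tilde X_J-G_J\|\ge\delta\big)\to0$; and under the same bound on the eigenvalues of $G_J$, $P(\hat k=r,\ \frac1n\tilde X_J^T\tilde X_J\text{ singular})\to0$ and for every $\eta>0$ there is $C$ with $P\big(\hat k=r,\ \|(\frac1n\tilde X_J^T\tilde X_J)^{-1}\|_{\rm spec}>C\big)\le\eta$ for all large $n$. In particular, if $P(\hat k=r)\to1$, the assertions of part 1 hold for $\hat F=\hat F^{\hat k}$. -/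

import Mathlib

open MeasureTheory Filter Topology Matrix

noncomputable section

/-! ### Matrix notions -/

/-- Squared Frobenius norm. -/
def frobSq {ι κ : Type*} [Fintype ι] [Fintype κ] (A : Matrix ι κ ℝ) : ℝ :=
  ∑ i, ∑ j, A i j ^ 2

/-- Frobenius norm. -/
def frob {ι κ : Type*} [Fintype ι] [Fintype κ] (A : Matrix ι κ ℝ) : ℝ :=
  Real.sqrt (frobSq A)

/-- Spectral norm: the operator norm for the Euclidean norm. -/
def specNorm {ι : Type*} [Fintype ι] [DecidableEq ι] (A : Matrix ι ι ℝ) : ℝ :=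
  ‖Matrix.toEuclideanCLM (n := ι) (𝕜 := ℝ) A‖

/-- `P_F = F (Fᵀ F)⁻¹ Fᵀ`. -/
def projMat {n k : ℕ} (F : Matrix (Fin n) (Fin k) ℝ) : Matrix (Fin n) (Fin n) ℝ :=
  F * (Fᵀ * F)⁻¹ * Fᵀ

/-- The columns of `X` with index in `J`. -/
def selectCols {n p : ℕ} (X : Matrix (Fin n) (Fin p) ℝ) (J : Finset (Fin p)) :
    Matrix (Fin n) J ℝ :=
  X.submatrix id Subtype.val

/-- `X̃_J = (I - P_F) X_J`. -/
def projectedCols {n p k : ℕ} (X : Matrix (Fin n) (Fin p) ℝ) (J : Finset (Fin p))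
    (F : Matrix (Fin n) (Fin k) ℝ) : Matrix (Fin n) J ℝ :=
  (1 - projMat F) * selectCols X J

/-- `(1/n) X̃_Jᵀ X̃_J`. -/
def projectedGram {n p k : ℕ} (X : Matrix (Fin n) (Fin p) ℝ) (J : Finset (Fin p))
    (F : Matrix (Fin n) (Fin k) ℝ) : Matrix J J ℝ :=
  (n : ℝ)⁻¹ • ((projectedCols X J F)ᵀ * projectedCols X J F)

/-! ### Estimation of the factors and of their number -/

/-- The columns of `L` are `√p` times orthonormal eigenvectors of the `p × p` matrix `Xᵀ X` that
correspond to its `k` largest eigenvalues, counted with multiplicity: every eigenvector orthogonal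
to all columns has an eigenvalue that is at most each of the eigenvalues `d i` of the columns. -/
def IsLoadingEstimate {n p k : ℕ} (X : Matrix (Fin n) (Fin p) ℝ)
    (L : Matrix (Fin p) (Fin k) ℝ) : Prop :=
  Lᵀ * L = (p : ℝ) • (1 : Matrix (Fin k) (Fin k) ℝ) ∧
  ∃ d : Fin k → ℝ,
    Xᵀ * X * L = L * Matrix.diagonal d ∧
    ∀ (μ : ℝ) (v : Fin p → ℝ), v ≠ 0 → (Xᵀ * X) *ᵥ v = μ • v → Lᵀ *ᵥ v = 0 → ∀ i, μ ≤ d i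

/-- `Fhat` is a matrix of `k` estimated factors:
`Fhat = Fbar (Fbarᵀ Fbar / n)^{1/2}` with `Fbar = X L / p` and `L` the loading estimate. -/
def IsFactorEstimate {n p k : ℕ} (X : Matrix (Fin n) (Fin p) ℝ)
    (Fhat : Matrix (Fin n) (Fin k) ℝ) : Prop :=
  ∃ (L : Matrix (Fin p) (Fin k) ℝ) (Fbar : Matrix (Fin n) (Fin k) ℝ)
    (S : Matrix (Fin k) (Fin k) ℝ),
    IsLoadingEstimate X L ∧
    Fbar = (p : ℝ)⁻¹ • (X * L) ∧
    S.PosSemidef ∧ S * S = (n : ℝ)⁻¹ • (Fbarᵀ * Fbar) ∧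
    Fhat = Fbar * S

/-- `V(k)`, the least squared Frobenius distance of `X` to the matrices `Fhat Lᵀ`. -/
def residualSq {n p k : ℕ} (X : Matrix (Fin n) (Fin p) ℝ)
    (Fhat : Matrix (Fin n) (Fin k) ℝ) : ℝ :=
  ⨅ L : Matrix (Fin p) (Fin k) ℝ, frobSq (X - Fhat * Lᵀ)

/-- `IC(k) = log V(k) + k ((n+p)/(np)) log (np/(n+p))`, with `log 0 = -∞`. -/
def infoCriterion {n p k : ℕ} (X : Matrix (Fin n) (Fin p) ℝ)
    (Fhat : Matrix (Fin n) (Fin k) ℝ) : EReal :=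
  ENNReal.log (ENNReal.ofReal (residualSq X Fhat)) +
    (((k : ℝ) * (((n : ℝ) + p) / ((n : ℝ) * p)) *
      Real.log (((n : ℝ) * p) / ((n : ℝ) + p)) : ℝ) : EReal)

/-- `k` minimizes the information criterion over `1, …, kmax`. -/
def IsSelectedRank {n p : ℕ} (X : Matrix (Fin n) (Fin p) ℝ) (kmax : ℕ)
    (Fhat : (k : ℕ) → Matrix (Fin n) (Fin k) ℝ) (k : ℕ) : Prop :=
  k ∈ Finset.Icc 1 kmax ∧
  ∀ l ∈ Finset.Icc 1 kmax, infoCriterion X (Fhat k) ≤ infoCriterion X (Fhat l)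

/-! ### The model -/

/-- `E Z ≤ M`, the expectation being finite. -/
def MeanLE {Ω : Type*} [MeasurableSpace Ω] (P : Measure Ω) (Z : Ω → ℝ) (M : ℝ) : Prop :=
  Integrable Z P ∧ ∫ ω, Z ω ∂P ≤ M

/-- Linear regression whose predictors have `r` common factors, one model for each sample size
`n`. The number `p n` of predictors, the coefficients `β n`, the loadings `lam n` and the set `J n`
are not random; the factors `f n t`, the idiosyncratic components `e n t j` and the errors
`ε n t` are random variables. -/
structure FactorRegression (Ω : Type*) [MeasurableSpace Ω] (r : ℕ) where
  p : ℕ → ℕ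
  J : (n : ℕ) → Finset (Fin (p n))
  β : (n : ℕ) → Fin (p n) → ℝ
  lam : (n : ℕ) → Fin (p n) → EuclideanSpace ℝ (Fin r)
  f : (n : ℕ) → Fin n → Ω → EuclideanSpace ℝ (Fin r)
  e : (n : ℕ) → Fin n → Fin (p n) → Ω → ℝ
  ε : (n : ℕ) → Fin n → Ω → ℝ
  measurable_f : ∀ n t, Measurable (f n t)
  measurable_e : ∀ n t j, Measurable (e n t j)
  measurable_ε : ∀ n t, Measurable (ε n t)

namespace FactorRegression

variable {Ω : Type*} [MeasurableSpace Ω] {r : ℕ} (D : FactorRegression Ω r)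

/-- `m`, the number of selected predictors. -/
def m (n : ℕ) : ℕ := (D.J n).card

/-- The predictors `x_{tj} = λ_jᵀ f_t + e_{tj}`. -/
def X (n : ℕ) (ω : Ω) : Matrix (Fin n) (Fin (D.p n)) ℝ :=
  Matrix.of fun t j => inner ℝ (D.lam n j) (D.f n t ω) + D.e n t j ω

/-- The responses `y_t = ∑ j, β_j x_{tj} + ε_t`. -/
def y (n : ℕ) (ω : Ω) (t : Fin n) : ℝ := ∑ j, D.β n j * D.X n ω t j + D.ε n t ω

/-- The factor matrix, with rows `f_t`. -/
def F (n : ℕ) (ω : Ω) : Matrix (Fin n) (Fin r) ℝ := Matrix.of fun t a => D.f n t ω a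

/-- The loading matrix, with rows `λ_j`. -/
def Lam (n : ℕ) : Matrix (Fin (D.p n)) (Fin r) ℝ := Matrix.of fun j a => D.lam n j a

/-- The matrix of idiosyncratic components. -/
def E (n : ℕ) (ω : Ω) : Matrix (Fin n) (Fin (D.p n)) ℝ := Matrix.of fun t j => D.e n t j ω

/-- Model design. The representation of the predictors by factors and idiosyncratic components is
part of the definition of `X`. -/
structure AssumptionA (M : ℝ) : Prop where
  p_large : ∃ c : ℝ, 0 < c ∧ ∀ᶠ n : ℕ in atTop, c * n ≤ D.p n
  m_small : Tendsto (fun n : ℕ => (D.m n : ℝ) ^ 2 / n) atTop (𝓝 0)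
  β_bound : ∀ n, ∑ j, |D.β n j| ≤ M

/-- Factors, loadings and idiosyncratic components. -/
structure AssumptionB (P : Measure Ω) (M : ℝ) : Prop where
  f_moment : ∀ n t, Integrable (fun ω => ‖D.f n t ω‖ ^ 4) P
  f_cov : ∃ SF : Matrix (Fin r) (Fin r) ℝ, SF.PosDef ∧
    ∀ δ : ℝ, 0 < δ → Tendsto (fun n : ℕ =>
      P {ω | δ ≤ frob ((n : ℝ)⁻¹ • ((D.F n ω)ᵀ * D.F n ω) - SF)}) atTop (𝓝 0)
  lam_bound : ∃ b : ℝ, ∀ n j, ‖D.lam n j‖ ≤ b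
  lam_cov : ∃ SL : Matrix (Fin r) (Fin r) ℝ, SL.PosDef ∧
    Tendsto (fun n : ℕ => frob ((D.p n : ℝ)⁻¹ • ((D.Lam n)ᵀ * D.Lam n) - SL)) atTop (𝓝 0)
  e_mean : ∀ n t i, ∫ ω, D.e n t i ω ∂P = 0
  e_moment : ∀ n t i, MeanLE P (fun ω => |D.e n t i ω| ^ 8) M
  e_serial_diag : ∀ n s,
    |∫ ω, (D.p n : ℝ)⁻¹ * ∑ i, D.e n s i ω * D.e n s i ω ∂P| ≤ M
  e_serial : ∀ n : ℕ,
    (n : ℝ)⁻¹ * ∑ s, ∑ t, |∫ ω, (D.p n : ℝ)⁻¹ * ∑ i, D.e n s i ω * D.e n t i ω ∂P| ≤ M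
  e_cross : ∀ n, ∃ τ : Fin (D.p n) → Fin (D.p n) → ℝ,
    (∀ t i j, |∫ ω, D.e n t i ω * D.e n t j ω ∂P| ≤ |τ i j|) ∧
    (D.p n : ℝ)⁻¹ * ∑ i, ∑ j, |τ i j| ≤ M
  e_joint : ∀ n : ℕ,
    ((n : ℝ) * D.p n)⁻¹ *
      ∑ i, ∑ j, ∑ t, ∑ s, |∫ ω, D.e n t i ω * D.e n s j ω ∂P| ≤ M
  e_fourth : ∀ n t s,
    MeanLE P (fun ω => |(Real.sqrt (D.p n))⁻¹ *
      ∑ i, (D.e n s i ω * D.e n t i ω - ∫ ω', D.e n s i ω' * D.e n t i ω' ∂P)| ^ 4) M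
  f_e_weak : ∀ n,
    MeanLE P (fun ω => (D.p n : ℝ)⁻¹ *
      ∑ i, ‖(Real.sqrt n)⁻¹ • ∑ t, D.e n t i ω • D.f n t ω‖ ^ 2) M

/-- Selection set. -/
structure AssumptionC (P : Measure Ω) (M : ℝ)
    (G : (n : ℕ) → Matrix (D.J n) (D.J n) ℝ) : Prop where
  G_posDef : ∀ n, (G n).PosDef
  e_cov : ∀ δ : ℝ, 0 < δ → Tendsto (fun n : ℕ =>
    P {ω | δ ≤ frob ((n : ℝ)⁻¹ • ((selectCols (D.E n ω) (D.J n))ᵀ *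
      selectCols (D.E n ω) (D.J n)) - G n)}) atTop (𝓝 0)
  f_e_weak : ∀ n,
    MeanLE P (fun ω => (D.m n : ℝ)⁻¹ *
      ∑ j ∈ D.J n, ‖(Real.sqrt n)⁻¹ • ∑ t, D.e n t j ω • D.f n t ω‖ ^ 2) M
  ε_e_weak : ∀ n,
    MeanLE P (fun ω => (D.m n : ℝ)⁻¹ *
      ∑ j ∈ D.J n, ((Real.sqrt n)⁻¹ * ∑ t, D.ε n t ω * D.e n t j ω) ^ 2) M
  e_e_weak : ∀ n, ∀ i ∉ D.J n,
    MeanLE P (fun ω => (D.m n : ℝ)⁻¹ *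
      ∑ j ∈ D.J n, ((Real.sqrt n)⁻¹ * ∑ t, D.e n t i ω * D.e n t j ω) ^ 2) M

end FactorRegression

end

section

open scoped Matrix.Norms.Frobenius

/-! ### The Frobenius norm and quadratic forms -/

/-! Only the column space of `Fhat` matters, and it is that of `Fbar = X L / p`, because the root
`S` of the Gram matrix is invertible for large `n`. From `X = F Lamᵀ + E` one gets `Fbar = F H + R`
with `H = Lamᵀ L / p` and `R = E L / p`. Bounding `R` directly gives only the order `√n`. The
eigenvector equation `Xᵀ X L = L D` does better: `R D = E Xᵀ Fbar = E Lam Fᵀ Fbar + E Eᵀ Fbar`,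
which has order `n p` because the idiosyncratic components are weakly dependent and `p` is at least
of order `n`. The eigenvalues in `D` are at least of order `n p` (`eigenvalue_lower_bound`). Hence
`R = O(1)`, while `F` and `Fbar` have order `√n`.

Let `Q` be the projection on the columns of `Fbar`. Since `Q Fbar = Fbar`, `(1 - Q) F H = -(1 - Q)
R`, and `H` has a bounded inverse, so `(1 - Q) F = O(1)` (`norm_sub_projMat_mul_le`). Also `Q EJ =
O(√m)`, because `Fᵀ EJ` and `EJ` both have order `√(n m)` (`norm_projMat_mul_le`). The projected
columns are therefore `EJ + B` with `B = O(√m)`, and their normalized Gram matrix differs from that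
of `EJ` by `O(m / √n)`, which tends to zero since `m² / n` does. No convergence of `H` is needed.

All of this is deterministic (`norm_projected_gram_sub_le`), with constants that depend only on the
size bounds in `ModelBounds`. Probability enters in `exists_modelBounds`: by Markov's inequality and
the convergence of `Fᵀ F / n`, these bounds hold outside an event of small probability.
Invertibility follows by perturbation of `G`, and the claims for the selected rank follow by
monotonicity of `P`, since the two estimates agree where `khat = r`. -/

lemma norm_sq_eq_frobSq {ι κ : Type*} [Fintype ι] [Fintype κ] (A : Matrix ι κ ℝ) :
    ‖A‖ ^ 2 = frobSq A := by
  have h : 0 ≤ ∑ i, ∑ j, A i j ^ 2 := by positivity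
  rw [Matrix.frobenius_norm_def, frobSq]
  simp only [Real.rpow_two, Real.norm_eq_abs, sq_abs]
  rw [← Real.sqrt_eq_rpow, Real.sq_sqrt h]

lemma frob_eq_norm {ι κ : Type*} [Fintype ι] [Fintype κ] (A : Matrix ι κ ℝ) :
    frob A = ‖A‖ := by
  rw [frob, ← norm_sq_eq_frobSq, Real.sqrt_sq (norm_nonneg _)]

lemma dotProduct_self_nonneg' {ι : Type*} [Fintype ι] (v : ι → ℝ) : 0 ≤ v ⬝ᵥ v :=
  Finset.sum_nonneg fun i _ => mul_self_nonneg (v i)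

lemma dotProduct_sq_le {ι : Type*} [Fintype ι] (v w : ι → ℝ) :
    (v ⬝ᵥ w) ^ 2 ≤ (v ⬝ᵥ v) * (w ⬝ᵥ w) := by
  have := Finset.sum_mul_sq_le_sq_mul_sq Finset.univ v w
  simpa [dotProduct, sq] using this

lemma mulVec_dotProduct_self {ι κ : Type*} [Fintype ι] [Fintype κ] (A : Matrix ι κ ℝ)
    (v : κ → ℝ) : (A *ᵥ v) ⬝ᵥ (A *ᵥ v) = v ⬝ᵥ ((Aᵀ * A) *ᵥ v) := by
  rw [← Matrix.mulVec_mulVec, Matrix.dotProduct_mulVec v, Matrix.vecMul_transpose]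

lemma frobSq_eq_sum_row {ι κ : Type*} [Fintype ι] [Fintype κ] (A : Matrix ι κ ℝ) :
    frobSq A = ∑ i, A i ⬝ᵥ A i := by
  simp [frobSq, dotProduct, sq]

lemma frobSq_eq_sum_col {ι κ : Type*} [Fintype ι] [Fintype κ] (A : Matrix ι κ ℝ) :
    frobSq A = ∑ j, Aᵀ j ⬝ᵥ Aᵀ j := by
  rw [frobSq, Finset.sum_comm]
  simp [dotProduct, sq]

lemma mulVec_dotProduct_self_le {ι κ : Type*} [Fintype ι] [Fintype κ] (A : Matrix ι κ ℝ)
    (v : κ → ℝ) : (A *ᵥ v) ⬝ᵥ (A *ᵥ v) ≤ ‖A‖ ^ 2 * (v ⬝ᵥ v) := by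
  rw [norm_sq_eq_frobSq, frobSq_eq_sum_row, Finset.sum_mul]
  refine Finset.sum_le_sum fun i _ => ?_
  have := dotProduct_sq_le (A i) v
  simpa [Matrix.mulVec, sq] using this

lemma dotProduct_mulVec_sq_le {ι : Type*} [Fintype ι] (A : Matrix ι ι ℝ) (v : ι → ℝ) :
    |v ⬝ᵥ (A *ᵥ v)| ≤ ‖A‖ * (v ⬝ᵥ v) := by
  have h0 := dotProduct_self_nonneg' v
  refine abs_le_of_sq_le_sq ?_ (by positivity)
  have h1 := dotProduct_sq_le v (A *ᵥ v)
  have h2 := mulVec_dotProduct_self_le A v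
  nlinarith [mul_le_mul_of_nonneg_left h2 h0]

/-- A lower bound `κ |v|² ≤ |A v|²` carries over to the columns of a matrix. -/
lemma le_norm_mul_sq {ι κ ν : Type*} [Fintype ι] [Fintype κ] [Fintype ν] {A : Matrix ι κ ℝ}
    {a : ℝ} (hA : ∀ v : κ → ℝ, a * (v ⬝ᵥ v) ≤ (A *ᵥ v) ⬝ᵥ (A *ᵥ v)) (B : Matrix κ ν ℝ) :
    a * ‖B‖ ^ 2 ≤ ‖A * B‖ ^ 2 := by
  rw [norm_sq_eq_frobSq, norm_sq_eq_frobSq, frobSq_eq_sum_col, frobSq_eq_sum_col, Finset.mul_sum]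
  refine Finset.sum_le_sum fun j _ => ?_
  exact hA (Bᵀ j)

lemma norm_one_sq {r : ℕ} : ‖(1 : Matrix (Fin r) (Fin r) ℝ)‖ ^ 2 = r := by
  rw [norm_sq_eq_frobSq, frobSq]
  simp [Matrix.one_apply]

lemma add_dotProduct_add_self_le {ι : Type*} [Fintype ι] (v w : ι → ℝ) :
    (v + w) ⬝ᵥ (v + w) ≤ 2 * (v ⬝ᵥ v) + 2 * (w ⬝ᵥ w) := by
  have := dotProduct_self_nonneg' (v - w)
  simp only [sub_dotProduct, dotProduct_sub, add_dotProduct, dotProduct_add] at *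
  linarith

/-- A square matrix that is bounded below is invertible, and its inverse is bounded. -/
lemma isUnit_of_le_mulVec {ι : Type*} [Fintype ι] [DecidableEq ι] {A : Matrix ι ι ℝ} {a : ℝ}
    (ha : 0 < a) (hA : ∀ v : ι → ℝ, a * (v ⬝ᵥ v) ≤ (A *ᵥ v) ⬝ᵥ (A *ᵥ v)) : IsUnit A := by
  rw [Matrix.isUnit_iff_isUnit_det, isUnit_iff_ne_zero]
  intro h
  obtain ⟨v, hv, hAv⟩ := Matrix.exists_mulVec_eq_zero_iff.mpr h
  have h1 := hA v
  rw [hAv, zero_dotProduct] at h1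
  have h2 : v ⬝ᵥ v = 0 := le_antisymm (by nlinarith) (dotProduct_self_nonneg' v)
  exact hv (dotProduct_self_eq_zero.mp h2)

/-! ### Eigenvectors for the largest eigenvalues -/

section Loading

variable {n p k : ℕ} {X : Matrix (Fin n) (Fin p) ℝ} {L : Matrix (Fin p) (Fin k) ℝ}
  {d : Fin k → ℝ}

/-- Makes the Gram matrix of `Fbar` equal to `D / p`, so that its inverse and its lower bound can be
read off the eigenvalues. -/
lemma gram_mul_loading (hL : Lᵀ * L = (p : ℝ) • (1 : Matrix (Fin k) (Fin k) ℝ))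
    (hd : Xᵀ * X * L = L * Matrix.diagonal d) :
    (X * L)ᵀ * (X * L) = (p : ℝ) • Matrix.diagonal d := by
  rw [Matrix.transpose_mul, Matrix.mul_assoc, ← Matrix.mul_assoc Xᵀ, hd, ← Matrix.mul_assoc, hL,
    Matrix.smul_mul, Matrix.one_mul]

lemma eigenvalue_nonneg (hp : 0 < p) (hL : Lᵀ * L = (p : ℝ) • (1 : Matrix (Fin k) (Fin k) ℝ))
    (hd : Xᵀ * X * L = L * Matrix.diagonal d) (i : Fin k) : 0 ≤ d i := by
  have h := congrFun (congrFun (gram_mul_loading hL hd) i) i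
  have h2 : 0 ≤ ((X * L)ᵀ * (X * L)) i i := by
    rw [Matrix.mul_apply]
    exact Finset.sum_nonneg fun j _ => mul_self_nonneg _
  rw [h] at h2
  simp only [Matrix.smul_apply, Matrix.diagonal_apply_eq, smul_eq_mul] at h2
  exact nonneg_of_mul_nonneg_right h2 (by exact_mod_cast hp)

/-- On the part of the space orthogonal to the other chosen eigenvectors, the quadratic form of
`Xᵀ X` is controlled by the eigenvalue `d i`. -/
lemma quadratic_form_le (hp : 0 < p)
    (hL : Lᵀ * L = (p : ℝ) • (1 : Matrix (Fin k) (Fin k) ℝ))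
    (hd : Xᵀ * X * L = L * Matrix.diagonal d)
    (hmax : ∀ (μ : ℝ) (v : Fin p → ℝ), v ≠ 0 → (Xᵀ * X) *ᵥ v = μ • v → Lᵀ *ᵥ v = 0 →
      ∀ i, μ ≤ d i)
    (i : Fin k) (v : Fin p → ℝ) (hv : ∀ j, j ≠ i → (Lᵀ *ᵥ v) j = 0) :
    (X *ᵥ v) ⬝ᵥ (X *ᵥ v) ≤ 2 * d i * (v ⬝ᵥ v) := by
  have hp' : (0 : ℝ) < p := by exact_mod_cast hp
  have hdi := eigenvalue_nonneg hp hL hd i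
  -- Deflation: `B` is the part of `Xᵀ X` on the span of the columns of `L`, and `A` is what
  -- remains, with `A L = 0`.
  set B : Matrix (Fin p) (Fin p) ℝ := (p : ℝ)⁻¹ • (L * Matrix.diagonal d * Lᵀ) with hB
  set A : Matrix (Fin p) (Fin p) ℝ := Xᵀ * X - B with hA
  have hBL : B * L = L * Matrix.diagonal d := by
    rw [hB, Matrix.smul_mul, Matrix.mul_assoc, hL, Matrix.mul_smul, Matrix.mul_one, smul_smul,
      inv_mul_cancel₀ hp'.ne', one_smul]
  have hBT : Bᵀ = B := by
    simp [hB, Matrix.transpose_mul, Matrix.mul_assoc]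
  have hAT : Aᵀ = A := by
    rw [hA, Matrix.transpose_sub, hBT]; simp
  have hAL : A * L = 0 := by rw [hA, Matrix.sub_mul, hd, hBL, sub_self]
  have hLA : Lᵀ * A = 0 := by
    have := congrArg Matrix.transpose hAL
    rwa [Matrix.transpose_mul, hAT, Matrix.transpose_zero] at this
  have hherm : (d i • (1 : Matrix (Fin p) (Fin p) ℝ) - A).IsHermitian := by
    rw [Matrix.IsHermitian, Matrix.conjTranspose_eq_transpose_of_trivial, Matrix.transpose_sub, hAT]
    simp
  have hpsd : (d i • (1 : Matrix (Fin p) (Fin p) ℝ) - A).PosSemidef := by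
    rw [hherm.posSemidef_iff_eigenvalues_nonneg]
    intro l
    set w : Fin p → ℝ := ⇑(hherm.eigenvectorBasis l) with hw
    set ν := hherm.eigenvalues l with hν
    have hw0 : w ≠ 0 := by
      intro h0
      have := hherm.eigenvectorBasis.orthonormal.ne_zero l
      apply this
      ext j
      exact congrFun h0 j
    have h1 : (d i • (1 : Matrix (Fin p) (Fin p) ℝ) - A) *ᵥ w = ν • w :=
      hherm.mulVec_eigenvectorBasis l
    have h2 : A *ᵥ w = (d i - ν) • w := by
      rw [Matrix.sub_mulVec, Matrix.smul_mulVec, Matrix.one_mulVec] at h1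
      rw [sub_smul, ← h1]; abel
    change 0 ≤ ν
    -- If `w` belongs to the eigenvalue zero of `A`, then `ν = d i`. Otherwise `Lᵀ A = 0` makes `w`
    -- orthogonal to the columns of `L`, so it is an eigenvector of `Xᵀ X` to which `hmax` applies.
    by_cases h3 : d i - ν = 0
    · linarith
    have h4 : Lᵀ *ᵥ w = 0 := by
      have : (d i - ν) • (Lᵀ *ᵥ w) = 0 := by
        rw [← Matrix.mulVec_smul, ← h2, Matrix.mulVec_mulVec, hLA, Matrix.zero_mulVec]
      exact (smul_eq_zero.mp this).resolve_left h3
    have h5 : B *ᵥ w = 0 := by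
      rw [hB, Matrix.smul_mulVec, ← Matrix.mulVec_mulVec, h4, Matrix.mulVec_zero, smul_zero]
    have h6 : (Xᵀ * X) *ᵥ w = (d i - ν) • w := by
      rw [← h2, hA, Matrix.sub_mulVec, h5, sub_zero]
    have := hmax _ w hw0 h6 h4 i
    linarith
  have h1 : v ⬝ᵥ (A *ᵥ v) ≤ d i * (v ⬝ᵥ v) := by
    have := hpsd.dotProduct_mulVec_nonneg v
    rw [Matrix.sub_mulVec, Matrix.smul_mulVec, Matrix.one_mulVec, dotProduct_sub,
      dotProduct_smul] at this
    simp only [star_trivial, smul_eq_mul] at this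
    linarith
  have h2 : v ⬝ᵥ (B *ᵥ v) = (p : ℝ)⁻¹ * (d i * (Lᵀ *ᵥ v) i ^ 2) := by
    rw [hB, Matrix.smul_mulVec, dotProduct_smul, ← Matrix.mulVec_mulVec, ← Matrix.mulVec_mulVec,
      Matrix.dotProduct_mulVec, ← Matrix.mulVec_transpose, smul_eq_mul]
    congr 1
    rw [dotProduct, Finset.sum_eq_single i]
    · rw [Matrix.mulVec_diagonal]; ring
    · intro j _ hj
      rw [hv j hj, zero_mul]
    · simp
  -- Cauchy–Schwarz with a column of squared length `p`: `B` contributes at most `d i |v|²`, as `A`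
  -- does. Adding the two costs the factor 2, which is harmless here.
  have h3 : (Lᵀ *ᵥ v) i ^ 2 ≤ p * (v ⬝ᵥ v) := by
    have h4 := dotProduct_sq_le (Lᵀ i) v
    have h5 : Lᵀ i ⬝ᵥ Lᵀ i = p := by
      have := congrFun (congrFun hL i) i
      simpa [Matrix.mul_apply, dotProduct] using this
    rw [h5] at h4
    exact h4
  have h4 : (p : ℝ)⁻¹ * (d i * (Lᵀ *ᵥ v) i ^ 2) ≤ d i * (v ⬝ᵥ v) := by
    rw [inv_mul_le_iff₀ hp']
    nlinarith
  rw [mulVec_dotProduct_self, show Xᵀ * X = A + B by rw [hA]; abel, Matrix.add_mulVec,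
    dotProduct_add, h2]
  linarith

/-- The `k` largest eigenvalues of `Xᵀ X`, for `X` with `k` strong factors, are of order `n p`. -/
lemma eigenvalue_lower_bound {F : Matrix (Fin n) (Fin k) ℝ} {Lam : Matrix (Fin p) (Fin k) ℝ}
    {E : Matrix (Fin n) (Fin p) ℝ} {K κ : ℝ} (hK : 0 < K) (hκ : 0 < κ) (hp : 0 < p)
    (hpK : 4 * K ^ 2 ≤ κ ^ 3 * p)
    (hF : ∀ v : Fin k → ℝ, n * κ * (v ⬝ᵥ v) ≤ v ⬝ᵥ ((Fᵀ * F) *ᵥ v))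
    (hLam : ∀ v : Fin k → ℝ, p * κ * (v ⬝ᵥ v) ≤ v ⬝ᵥ ((Lamᵀ * Lam) *ᵥ v))
    (hLamK : ‖Lam‖ ≤ K * √p) (hE : ‖E * Lam‖ ≤ K * (√n * √p))
    (hL : Lᵀ * L = (p : ℝ) • (1 : Matrix (Fin k) (Fin k) ℝ))
    (hX : X = F * Lamᵀ + E)
    (hd : Xᵀ * X * L = L * Matrix.diagonal d)
    (hmax : ∀ (μ : ℝ) (v : Fin p → ℝ), v ≠ 0 → (Xᵀ * X) *ᵥ v = μ • v → Lᵀ *ᵥ v = 0 →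
      ∀ i, μ ≤ d i) (i : Fin k) :
    κ ^ 3 / (8 * K ^ 2) * (n * p) ≤ d i := by
  have hp' : (0 : ℝ) < p := by exact_mod_cast hp
  have hn' : (0 : ℝ) ≤ n := Nat.cast_nonneg n
  have hdi := eigenvalue_nonneg hp hL hd i
  -- There are `k - 1` linear conditions on `k` unknowns; replacing row `i` by zero turns them into
  -- a singular square system.
  obtain ⟨a, ha, haL⟩ : ∃ a : Fin k → ℝ, a ≠ 0 ∧ ∀ j, j ≠ i → (Lᵀ *ᵥ (Lam *ᵥ a)) j = 0 := by
    have hdet : ((Lᵀ * Lam).updateRow i 0).det = 0 :=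
      Matrix.det_eq_zero_of_row_eq_zero i (fun j => by simp)
    obtain ⟨a, ha, h⟩ := Matrix.exists_mulVec_eq_zero_iff.mpr hdet
    refine ⟨a, ha, fun j hj => ?_⟩
    have := congrFun h j
    rw [Matrix.mulVec_mulVec]
    simpa [Matrix.mulVec, Matrix.updateRow_ne hj] using this
  have ha0 : 0 < a ⬝ᵥ a := lt_of_le_of_ne (dotProduct_self_nonneg' a)
    fun h => ha (dotProduct_self_eq_zero.mp h.symm)
  have h1 := quadratic_form_le hp hL hd hmax i (Lam *ᵥ a) haL
  have h2 : (Lam *ᵥ a) ⬝ᵥ (Lam *ᵥ a) ≤ K ^ 2 * p * (a ⬝ᵥ a) := by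
    refine (mulVec_dotProduct_self_le Lam a).trans ?_
    gcongr
    calc ‖Lam‖ ^ 2 ≤ (K * √p) ^ 2 := by gcongr
      _ = K ^ 2 * p := by rw [mul_pow, Real.sq_sqrt hp'.le]
  have h3 : ((E * Lam) *ᵥ a) ⬝ᵥ ((E * Lam) *ᵥ a) ≤ K ^ 2 * (n * p) * (a ⬝ᵥ a) := by
    refine (mulVec_dotProduct_self_le _ a).trans ?_
    gcongr
    calc ‖E * Lam‖ ^ 2 ≤ (K * (√n * √p)) ^ 2 := by gcongr
      _ = K ^ 2 * (n * p) := by rw [mul_pow, mul_pow, Real.sq_sqrt hp'.le, Real.sq_sqrt hn']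
  set b := (Lamᵀ * Lam) *ᵥ a with hb
  have h4 : (p * κ) ^ 2 * (a ⬝ᵥ a) ≤ b ⬝ᵥ b := by
    have h5 := hLam a
    have h6 := dotProduct_sq_le a b
    have h7 : (p * κ * (a ⬝ᵥ a)) ^ 2 ≤ (a ⬝ᵥ b) ^ 2 := by gcongr
    refine le_of_mul_le_mul_left ?_ ha0
    nlinarith
  have h5 : n * κ * ((p * κ) ^ 2 * (a ⬝ᵥ a)) ≤ (F *ᵥ b) ⬝ᵥ (F *ᵥ b) := by
    rw [mulVec_dotProduct_self]
    refine le_trans ?_ (hF b)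
    gcongr
  have h6 : F *ᵥ b = X *ᵥ (Lam *ᵥ a) + (-((E * Lam) *ᵥ a)) := by
    rw [hX, Matrix.add_mulVec, ← Matrix.mulVec_mulVec a E, hb, ← Matrix.mulVec_mulVec a,
      ← Matrix.mulVec_mulVec _ F]
    abel
  have h7 := add_dotProduct_add_self_le (X *ᵥ (Lam *ᵥ a)) (-((E * Lam) *ᵥ a))
  rw [← h6, neg_dotProduct_neg] at h7
  have h8 : 2 * d i * ((Lam *ᵥ a) ⬝ᵥ (Lam *ᵥ a)) ≤ 2 * d i * (K ^ 2 * p * (a ⬝ᵥ a)) := by gcongr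
  have h9 : n * κ * ((p * κ) ^ 2 * (a ⬝ᵥ a)) ≤
      4 * d i * (K ^ 2 * p * (a ⬝ᵥ a)) + 2 * (K ^ 2 * (n * p) * (a ⬝ᵥ a)) := by linarith
  have h10 : n * κ ^ 3 * p ≤ 4 * d i * K ^ 2 + 2 * K ^ 2 * n := by
    refine le_of_mul_le_mul_right ?_ (mul_pos hp' ha0)
    nlinarith
  -- By `hpK` the term `2 K² n` is at most half of `n κ³ p`, which leaves `n κ³ p / 2 ≤ 4 d i K²`;
  -- hence the 8.
  rw [div_mul_eq_mul_div, div_le_iff₀ (by positivity)]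
  nlinarith

end Loading

/-! ### The projection on the estimated factors -/

/-- The two matrices have the same column space when `Fᵀ F` is invertible. The cancellation needs no
such assumption, because `Matrix.mul_inv_rev` holds for singular matrices too. -/
lemma projMat_mul_of_isUnit {n k : ℕ} (F : Matrix (Fin n) (Fin k) ℝ)
    {S : Matrix (Fin k) (Fin k) ℝ} (hS : IsUnit S) : projMat (F * S) = projMat F := by
  have hd : IsUnit S.det := (Matrix.isUnit_iff_isUnit_det S).mp hS
  have hdT : IsUnit Sᵀ.det := by rwa [Matrix.det_transpose]
  have h : (F * S)ᵀ * (F * S) = Sᵀ * ((Fᵀ * F) * S) := by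
    simp only [Matrix.transpose_mul, Matrix.mul_assoc]
  rw [projMat, h, Matrix.mul_inv_rev, Matrix.mul_inv_rev, Matrix.transpose_mul, projMat]
  calc F * S * (S⁻¹ * (Fᵀ * F)⁻¹ * Sᵀ⁻¹) * (Sᵀ * Fᵀ)
      = F * (S * S⁻¹) * (Fᵀ * F)⁻¹ * (Sᵀ⁻¹ * Sᵀ) * Fᵀ := by simp only [Matrix.mul_assoc]
    _ = F * (Fᵀ * F)⁻¹ * Fᵀ := by
      rw [Matrix.mul_nonsing_inv _ hd, Matrix.nonsing_inv_mul _ hdT, Matrix.mul_one, Matrix.mul_one]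

lemma projMat_mul_self {n k : ℕ} {F : Matrix (Fin n) (Fin k) ℝ} (hF : IsUnit (Fᵀ * F)) :
    projMat F * F = F := by
  rw [projMat, Matrix.mul_assoc, Matrix.mul_assoc,
    Matrix.nonsing_inv_mul _ ((Matrix.isUnit_iff_isUnit_det _).mp hF), Matrix.mul_one]

lemma isUnit_gram_of_le_mulVec {n k : ℕ} {F : Matrix (Fin n) (Fin k) ℝ} {c : ℝ} (hc : 0 < c)
    (hF : ∀ v : Fin k → ℝ, c * (v ⬝ᵥ v) ≤ (F *ᵥ v) ⬝ᵥ (F *ᵥ v)) : IsUnit (Fᵀ * F) := by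
  rw [Matrix.isUnit_iff_isUnit_det, isUnit_iff_ne_zero]
  intro h
  obtain ⟨v, hv, hAv⟩ := Matrix.exists_mulVec_eq_zero_iff.mpr h
  have h1 := hF v
  rw [mulVec_dotProduct_self, hAv, dotProduct_zero] at h1
  have h2 : v ⬝ᵥ v = 0 := le_antisymm (by nlinarith) (dotProduct_self_nonneg' v)
  exact hv (dotProduct_self_eq_zero.mp h2)

lemma norm_diagonal_le {k : ℕ} {d : Fin k → ℝ} {B K : ℝ} (hB : 0 ≤ B) (hd : ∀ i, |d i| ≤ B)
    (hK : √(k : ℝ) ≤ K) : ‖Matrix.diagonal d‖ ≤ K * B := by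
  have h : ‖Matrix.diagonal d‖ ^ 2 ≤ (√(k : ℝ) * B) ^ 2 := by
    rw [norm_sq_eq_frobSq, frobSq, mul_pow, Real.sq_sqrt (Nat.cast_nonneg k)]
    calc ∑ i, ∑ j, Matrix.diagonal d i j ^ 2 = ∑ i, d i ^ 2 := by
          refine Finset.sum_congr rfl fun i _ => ?_
          rw [Finset.sum_eq_single i]
          · simp
          · intro j _ hj; simp [Matrix.diagonal_apply_ne' _ hj]
          · simp
      _ ≤ ∑ i : Fin k, B ^ 2 := Finset.sum_le_sum fun i _ => sq_le_sq' (abs_le.mp (hd i)).1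
            (abs_le.mp (hd i)).2
      _ = k * B ^ 2 := by simp
  exact (abs_le_of_sq_le_sq' h (by positivity)).2.trans (by gcongr)

/-- Used to pass from a bound on `R D` to one on `R`. Transposing turns multiplication on the right
into multiplication on the left, which `le_norm_mul_sq` covers. -/
lemma mul_norm_le_norm_mul_diagonal {n k : ℕ} (R : Matrix (Fin n) (Fin k) ℝ) {d : Fin k → ℝ}
    {c : ℝ} (hc : 0 ≤ c) (hd : ∀ i, c ≤ d i) : c * ‖R‖ ≤ ‖R * Matrix.diagonal d‖ := by
  refine (abs_le_of_sq_le_sq' ?_ (norm_nonneg _)).2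
  have h4 : ∀ v : Fin k → ℝ, c ^ 2 * (v ⬝ᵥ v) ≤
      (Matrix.diagonal d *ᵥ v) ⬝ᵥ (Matrix.diagonal d *ᵥ v) := by
    intro v
    rw [dotProduct, dotProduct, Finset.mul_sum]
    refine Finset.sum_le_sum fun i _ => ?_
    rw [Matrix.mulVec_diagonal]
    have : c ^ 2 ≤ d i ^ 2 := by
      have := hd i
      gcongr
    nlinarith [mul_le_mul_of_nonneg_right this (mul_self_nonneg (v i))]
  have h5 := le_norm_mul_sq h4 Rᵀ
  rw [Matrix.frobenius_norm_transpose, ← Matrix.frobenius_norm_transpose (Matrix.diagonal d * Rᵀ),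
    Matrix.transpose_mul, Matrix.transpose_transpose, Matrix.diagonal_transpose] at h5
  rwa [mul_pow]

lemma norm_inv_smul_diagonal_le {k : ℕ} {d : Fin k → ℝ} {c n p K : ℝ} (hc : 0 < c) (hn : 0 < n)
    (hp : 0 < p) (hd : ∀ i, c * (n * p) ≤ d i) (hK : √(k : ℝ) ≤ K) :
    ‖(p⁻¹ • Matrix.diagonal d)⁻¹‖ ≤ K / c / n := by
  have h1 : (p⁻¹ • Matrix.diagonal d)⁻¹ = Matrix.diagonal fun i => p * (d i)⁻¹ := by
    apply Matrix.inv_eq_right_inv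
    rw [Matrix.smul_mul, Matrix.diagonal_mul_diagonal, ← Matrix.diagonal_smul,
      ← Matrix.diagonal_one]
    congr 1
    funext i
    have : 0 < d i := lt_of_lt_of_le (by positivity) (hd i)
    simp only [Pi.smul_apply, smul_eq_mul]
    field_simp
  rw [h1]
  have h2 : ‖Matrix.diagonal fun i => p * (d i)⁻¹‖ ≤ K * (c * n)⁻¹ := by
    refine norm_diagonal_le (by positivity) (fun i => ?_) hK
    have h3 : 0 < d i := lt_of_lt_of_le (by positivity) (hd i)
    rw [abs_of_pos (by positivity), ← div_eq_mul_inv, div_le_iff₀ h3, inv_mul_eq_div,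
      le_div_iff₀ (by positivity)]
    linarith [hd i]
  rwa [mul_inv, ← mul_assoc, ← div_eq_mul_inv, ← div_eq_mul_inv] at h2

/-- If estimated factors `Fbar = F H + R` have a bounded error `R`, then the projection on them
annihilates `F` up to a bounded error. -/
lemma norm_sub_projMat_mul_le {n k : ℕ} {F Fbar R : Matrix (Fin n) (Fin k) ℝ}
    {H : Matrix (Fin k) (Fin k) ℝ} {a c : ℝ} (ha : 1 ≤ a) (hc : 0 < c)
    (hn : 4 * a ^ 2 ≤ c * n) (hk : √(k : ℝ) ≤ a)
    (hFbar : Fbar = F * H + R) (hR : ‖R‖ ≤ a)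
    (hF : ‖F‖ ≤ a * √n) (hFbarn : ‖Fbar‖ ≤ a * √n) (hinv : ‖(Fbarᵀ * Fbar)⁻¹‖ ≤ a / n)
    (hlow : ∀ v : Fin k → ℝ, c * n * (v ⬝ᵥ v) ≤ (Fbar *ᵥ v) ⬝ᵥ (Fbar *ᵥ v)) :
    ‖F - projMat Fbar * F‖ ≤ 2 * a ^ 4 * √(4 * a ^ 4 / c) := by
  have hn0 : (0 : ℝ) < n := by
    by_contra h
    have : (n : ℝ) ≤ 0 := not_lt.mp h
    nlinarith
  have hsn : 0 < √(n : ℝ) := Real.sqrt_pos.mpr hn0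
  have hsn2 : √(n : ℝ) * √n = n := Real.mul_self_sqrt hn0.le
  have ha0 : 0 < a := by linarith
  have hunit : IsUnit (Fbarᵀ * Fbar) := isUnit_gram_of_le_mulVec (by positivity) hlow
  have hP : ‖projMat Fbar‖ ≤ a ^ 3 := by
    calc ‖projMat Fbar‖ ≤ ‖Fbar‖ * ‖(Fbarᵀ * Fbar)⁻¹‖ * ‖Fbarᵀ‖ := by
          refine (Matrix.frobenius_norm_mul _ _).trans ?_
          gcongr
          exact Matrix.frobenius_norm_mul _ _
      _ ≤ (a * √n) * (a / n) * (a * √n) := by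
          rw [Matrix.frobenius_norm_transpose]; gcongr
      _ = a ^ 3 := by
          generalize √(n : ℝ) = q at hsn hsn2 ⊢
          rw [← hsn2]; field_simp
  -- `F H = Fbar - R` inherits the lower bound of `Fbar`: `hn` makes the contribution of `R`
  -- negligible, and dividing by `‖F‖² ≤ a² n` leaves a bound for `H` free of `n`.
  have hHlow : ∀ v : Fin k → ℝ, c / (4 * a ^ 2) * (v ⬝ᵥ v) ≤ (H *ᵥ v) ⬝ᵥ (H *ᵥ v) := by
    intro v
    have hv0 := dotProduct_self_nonneg' v
    have h1 := hlow v
    rw [hFbar, Matrix.add_mulVec] at h1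
    have h2 := add_dotProduct_add_self_le ((F * H) *ᵥ v) (R *ᵥ v)
    have h3 : (R *ᵥ v) ⬝ᵥ (R *ᵥ v) ≤ a ^ 2 * (v ⬝ᵥ v) := by
      refine (mulVec_dotProduct_self_le R v).trans ?_
      gcongr
    have h4 : ((F * H) *ᵥ v) ⬝ᵥ ((F * H) *ᵥ v) ≤ a ^ 2 * n * ((H *ᵥ v) ⬝ᵥ (H *ᵥ v)) := by
      rw [← Matrix.mulVec_mulVec]
      refine (mulVec_dotProduct_self_le F _).trans ?_
      have := dotProduct_self_nonneg' (H *ᵥ v)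
      gcongr
      calc ‖F‖ ^ 2 ≤ (a * √n) ^ 2 := by gcongr
        _ = a ^ 2 * n := by rw [mul_pow, Real.sq_sqrt hn0.le]
    have h5 := mul_le_mul_of_nonneg_right hn hv0
    rw [div_mul_eq_mul_div, div_le_iff₀ (by positivity)]
    refine le_of_mul_le_mul_left ?_ hn0
    nlinarith
  have hHunit : IsUnit H := isUnit_of_le_mulVec (by positivity) hHlow
  have hHdet := (Matrix.isUnit_iff_isUnit_det H).mp hHunit
  have hHinv : ‖H⁻¹‖ ≤ √(4 * a ^ 4 / c) := by
    apply Real.le_sqrt_of_sq_le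
    have h1 := le_norm_mul_sq hHlow H⁻¹
    rw [Matrix.mul_nonsing_inv _ hHdet, norm_one_sq] at h1
    have h2 : (k : ℝ) ≤ a ^ 2 := by
      rw [← Real.sq_sqrt (Nat.cast_nonneg (α := ℝ) k)]; gcongr
    rw [le_div_iff₀ hc]
    rw [div_mul_eq_mul_div, div_le_iff₀ (by positivity)] at h1
    nlinarith
  have hid : F - projMat Fbar * F = (projMat Fbar * R - R) * H⁻¹ := by
    have h1 : (F - projMat Fbar * F) * H = projMat Fbar * R - R := by
      have h2 : F * H = Fbar - R := by rw [hFbar]; abel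
      rw [Matrix.sub_mul, Matrix.mul_assoc, h2, Matrix.mul_sub, projMat_mul_self hunit]
      abel
    rw [← h1, Matrix.mul_assoc, Matrix.mul_nonsing_inv _ hHdet, Matrix.mul_one]
  rw [hid]
  refine (Matrix.frobenius_norm_mul _ _).trans ?_
  gcongr
  calc ‖projMat Fbar * R - R‖ ≤ ‖projMat Fbar‖ * ‖R‖ + ‖R‖ :=
        (norm_sub_le _ _).trans (by gcongr; exact Matrix.frobenius_norm_mul _ _)
    _ ≤ a ^ 3 * a + a := by gcongr
    _ ≤ 2 * a ^ 4 := by nlinarith [one_le_pow₀ ha (n := 3)]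

/-- If columns `EJ` are nearly orthogonal to the factors, then their projection on the estimated
factors is of the order of the square root of their number. -/
lemma norm_projMat_mul_le {n k : ℕ} {ι : Type*} [Fintype ι] {F Fbar R : Matrix (Fin n) (Fin k) ℝ}
    {H : Matrix (Fin k) (Fin k) ℝ} {EJ : Matrix (Fin n) ι ℝ} {a s : ℝ} (ha : 0 ≤ a)
    (hn : 0 < n) (hFbar : Fbar = F * H + R) (hR : ‖R‖ ≤ a) (hH : ‖H‖ ≤ a)
    (hFbarn : ‖Fbar‖ ≤ a * √n) (hinv : ‖(Fbarᵀ * Fbar)⁻¹‖ ≤ a / n)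
    (hE : ‖EJ‖ ≤ a * (√n * s)) (hFE : ‖Fᵀ * EJ‖ ≤ a * (√n * s)) :
    ‖projMat Fbar * EJ‖ ≤ 2 * a ^ 4 * s := by
  have hn0 : (0 : ℝ) < n := by exact_mod_cast hn
  have hsn : 0 < √(n : ℝ) := Real.sqrt_pos.mpr hn0
  have hsn2 : √(n : ℝ) * √n = n := Real.mul_self_sqrt hn0.le
  have h1 : ‖Fbarᵀ * EJ‖ ≤ 2 * a ^ 2 * (√n * s) := by
    have h2 : Fbarᵀ * EJ = Hᵀ * (Fᵀ * EJ) + Rᵀ * EJ := by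
      rw [hFbar, Matrix.transpose_add, Matrix.transpose_mul, Matrix.add_mul, Matrix.mul_assoc]
    rw [h2]
    calc ‖Hᵀ * (Fᵀ * EJ) + Rᵀ * EJ‖ ≤ ‖Hᵀ‖ * ‖Fᵀ * EJ‖ + ‖Rᵀ‖ * ‖EJ‖ :=
          (norm_add_le _ _).trans
            (add_le_add (Matrix.frobenius_norm_mul _ _) (Matrix.frobenius_norm_mul _ _))
      _ ≤ a * (a * (√n * s)) + a * (a * (√n * s)) := by
          rw [Matrix.frobenius_norm_transpose, Matrix.frobenius_norm_transpose]; gcongr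
      _ = _ := by ring
  have h3 : projMat Fbar * EJ = Fbar * ((Fbarᵀ * Fbar)⁻¹ * (Fbarᵀ * EJ)) := by
    simp only [projMat, Matrix.mul_assoc]
  rw [h3]
  calc ‖Fbar * ((Fbarᵀ * Fbar)⁻¹ * (Fbarᵀ * EJ))‖
      ≤ ‖Fbar‖ * (‖(Fbarᵀ * Fbar)⁻¹‖ * ‖Fbarᵀ * EJ‖) := by
        refine (Matrix.frobenius_norm_mul _ _).trans ?_
        gcongr
        exact Matrix.frobenius_norm_mul _ _
    _ ≤ (a * √n) * ((a / n) * (2 * a ^ 2 * (√n * s))) := by gcongr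
    _ = 2 * a ^ 4 * s := by
        generalize √(n : ℝ) = q at hsn hsn2 ⊢
        rw [← hsn2]; field_simp

/-- The Gram matrix of `EJ + B` for a small `B`. -/
lemma norm_gram_add_sub_le {n : ℕ} {ι : Type*} [Fintype ι] {EJ B : Matrix (Fin n) ι ℝ}
    {a b s : ℝ} (ha : 0 ≤ a) (hs : 0 ≤ s) (hb : 0 ≤ b) (hn : 0 < n)
    (hE : ‖EJ‖ ≤ a * (√n * s)) (hB : ‖B‖ ≤ b * s) :
    ‖(n : ℝ)⁻¹ • ((EJ + B)ᵀ * (EJ + B)) - (n : ℝ)⁻¹ • (EJᵀ * EJ)‖ ≤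
      (2 * a * b + b ^ 2) * (s ^ 2 / √n) := by
  have hn0 : (0 : ℝ) < n := by exact_mod_cast hn
  have hn1 : (1 : ℝ) ≤ n := by exact_mod_cast hn
  have hsn : 0 < √(n : ℝ) := Real.sqrt_pos.mpr hn0
  have hsn1 : 1 ≤ √(n : ℝ) := Real.one_le_sqrt.mpr hn1
  have hsn2 : √(n : ℝ) * √n = n := Real.mul_self_sqrt hn0.le
  have h1 : (EJ + B)ᵀ * (EJ + B) - EJᵀ * EJ = EJᵀ * B + Bᵀ * EJ + Bᵀ * B := by
    rw [Matrix.transpose_add, Matrix.add_mul, Matrix.mul_add, Matrix.mul_add]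
    abel
  rw [← smul_sub, h1, norm_smul, norm_inv, Real.norm_natCast]
  -- The quadratic term `Bᵀ B` lacks the factor `√n` of the cross terms; `1 ≤ √n` absorbs it.
  have h2 : ‖EJᵀ * B + Bᵀ * EJ + Bᵀ * B‖ ≤ (2 * a * b + b ^ 2) * (√n * s ^ 2) := by
    calc ‖EJᵀ * B + Bᵀ * EJ + Bᵀ * B‖ ≤ ‖EJᵀ‖ * ‖B‖ + ‖Bᵀ‖ * ‖EJ‖ + ‖Bᵀ‖ * ‖B‖ := by
          refine (norm_add_le _ _).trans (add_le_add ((norm_add_le _ _).trans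
            (add_le_add ?_ ?_)) ?_) <;> exact Matrix.frobenius_norm_mul _ _
      _ ≤ (a * (√n * s)) * (b * s) + (b * s) * (a * (√n * s)) + (b * s) * (b * s) := by
          simp only [Matrix.frobenius_norm_transpose]
          gcongr
      _ = 2 * a * b * (√n * s ^ 2) + b ^ 2 * (1 * s ^ 2) := by ring
      _ ≤ 2 * a * b * (√n * s ^ 2) + b ^ 2 * (√n * s ^ 2) := by gcongr
      _ = _ := by ring
  calc (n : ℝ)⁻¹ * ‖EJᵀ * B + Bᵀ * EJ + Bᵀ * B‖
      ≤ (n : ℝ)⁻¹ * ((2 * a * b + b ^ 2) * (√n * s ^ 2)) := by gcongr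
    _ = (2 * a * b + b ^ 2) * (s ^ 2 / √n) := by
        generalize √(n : ℝ) = q at hsn hsn2 ⊢
        rw [← hsn2]; field_simp

/-- The sizes of the parts of a factor model `X = F Lamᵀ + E` with strong factors, up to a
constant `K`; `EJ` and `LamJ` belong to a selection of `s²` columns. -/
structure ModelBounds {n p r : ℕ} {ι : Type*} [Fintype ι] (K κ s : ℝ)
    (F : Matrix (Fin n) (Fin r) ℝ) (Lam : Matrix (Fin p) (Fin r) ℝ) (E : Matrix (Fin n) (Fin p) ℝ)
    (EJ : Matrix (Fin n) ι ℝ) (LamJ : Matrix ι (Fin r) ℝ) : Prop where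
  n_pos : 0 < n
  p_pos : 0 < p
  rank_le : √(r : ℝ) ≤ K
  n_le : √(n : ℝ) ≤ K * √p
  F_le : ‖F‖ ≤ K * √n
  le_F : ∀ v : Fin r → ℝ, n * κ * (v ⬝ᵥ v) ≤ v ⬝ᵥ ((Fᵀ * F) *ᵥ v)
  Lam_le : ‖Lam‖ ≤ K * √p
  le_Lam : ∀ v : Fin r → ℝ, p * κ * (v ⬝ᵥ v) ≤ v ⬝ᵥ ((Lamᵀ * Lam) *ᵥ v)
  E_le : ‖E‖ ≤ K * (√n * √p)
  ELam_le : ‖E * Lam‖ ≤ K * (√n * √p)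
  EE_le : ‖E * Eᵀ‖ ≤ K * (√n * p)
  EJ_le : ‖EJ‖ ≤ K * (√n * s)
  FEJ_le : ‖Fᵀ * EJ‖ ≤ K * (√n * s)
  LamJ_le : ‖LamJ‖ ≤ K * s

set_option maxHeartbeats 1000000 in
/-- The Gram matrix of the selected columns, projected off the estimated factors, is close to that
of the selected idiosyncratic columns. -/
theorem norm_projected_gram_sub_le {K κ : ℝ} (hK : 1 ≤ K) (hκ : 0 < κ) :
    ∃ C N : ℝ, ∀ {n p r : ℕ} {ι : Type*} [Fintype ι] {s : ℝ}
      {F : Matrix (Fin n) (Fin r) ℝ} {Lam : Matrix (Fin p) (Fin r) ℝ}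
      {E : Matrix (Fin n) (Fin p) ℝ} {EJ : Matrix (Fin n) ι ℝ} {LamJ : Matrix ι (Fin r) ℝ},
      0 ≤ s → ModelBounds K κ s F Lam E EJ LamJ → N ≤ n →
      ∀ {Fhat : Matrix (Fin n) (Fin r) ℝ}, IsFactorEstimate (F * Lamᵀ + E) Fhat →
      ‖(n : ℝ)⁻¹ • (((1 - projMat Fhat) * (F * LamJᵀ + EJ))ᵀ *
          ((1 - projMat Fhat) * (F * LamJᵀ + EJ))) - (n : ℝ)⁻¹ • (EJᵀ * EJ)‖ ≤
        C * (s ^ 2 / √n) := by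
  have hK0 : 0 < K := by linarith
  obtain ⟨c, hc⟩ : ∃ c, c = κ ^ 3 / (8 * K ^ 2) := ⟨_, rfl⟩
  have hc0 : 0 < c := by rw [hc]; positivity
  -- The three summands bound `‖Fbar‖ / √n`, `‖R‖` and `n ‖(Fbarᵀ Fbar)⁻¹‖` respectively; a single
  -- `a` then serves in all later estimates.
  obtain ⟨a, ha⟩ : ∃ a, a = 2 * K ^ 3 + 4 * K ^ 6 / c + K / c := ⟨_, rfl⟩
  have ha1 : 2 * K ^ 3 ≤ a := by rw [ha]; linarith [show 0 < 4 * K ^ 6 / c + K / c by positivity]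
  have ha2 : 4 * K ^ 6 / c ≤ a := by rw [ha]; linarith [show 0 < 2 * K ^ 3 + K / c by positivity]
  have ha3 : K / c ≤ a := by
    rw [ha]; linarith [show 0 < 2 * K ^ 3 + 4 * K ^ 6 / c by positivity]
  have hKK : K ≤ K ^ 3 := le_self_pow₀ hK (by norm_num)
  have hKK2 : K ^ 2 ≤ K ^ 3 := pow_le_pow_right₀ hK (by norm_num)
  have haK : K ≤ a := by linarith
  have haK2 : K ^ 2 ≤ a := by nlinarith
  have ha0 : 1 ≤ a := hK.trans haK
  obtain ⟨b, hb⟩ : ∃ b, b = 2 * a ^ 4 * √(4 * a ^ 4 / c) * K + 2 * a ^ 4 := ⟨_, rfl⟩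
  have hb0 : 0 ≤ b := by rw [hb]; positivity
  refine ⟨2 * a * b + b ^ 2, max (4 * a ^ 2 / c) (4 * K ^ 4 / κ ^ 3), ?_⟩
  intro n p r ι _ s F Lam E EJ LamJ hs hM hN Fhat hFhat
  have hn0 : (0 : ℝ) < n := by exact_mod_cast hM.n_pos
  have hp0 : (0 : ℝ) < p := by exact_mod_cast hM.p_pos
  have hsn : 0 < √(n : ℝ) := Real.sqrt_pos.mpr hn0
  have hsp : 0 < √(p : ℝ) := Real.sqrt_pos.mpr hp0
  have hsn2 : √(n : ℝ) * √n = n := Real.mul_self_sqrt hn0.le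
  have hsp2 : √(p : ℝ) * √p = p := Real.mul_self_sqrt hp0.le
  have hN1 : 4 * a ^ 2 ≤ c * n := by
    have := (le_max_left _ _).trans hN
    rwa [div_le_iff₀ hc0, mul_comm (n : ℝ)] at this
  -- A lower bound on `n` becomes one on `p` through `n ≤ K² p`.
  have hN2 : 4 * K ^ 2 ≤ κ ^ 3 * p := by
    have h1 := (le_max_right _ _).trans hN
    rw [div_le_iff₀ (by positivity)] at h1
    have h2 : (n : ℝ) ≤ K ^ 2 * p := by
      calc (n : ℝ) = √n * √n := hsn2.symm
        _ ≤ (K * √p) * (K * √p) := by gcongr <;> exact hM.n_le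
        _ = K ^ 2 * p := by rw [mul_mul_mul_comm, hsp2]; ring
    have h3 : (n : ℝ) * κ ^ 3 ≤ K ^ 2 * p * κ ^ 3 := by gcongr
    refine le_of_mul_le_mul_left ?_ (pow_pos hK0 2)
    nlinarith
  obtain ⟨L, Fbar, S, ⟨hL, d, hd, hmax⟩, hFbar, -, hSS, rfl⟩ := hFhat
  have hdlow : ∀ i, c * (n * p) ≤ d i := by
    intro i
    rw [hc]
    exact eigenvalue_lower_bound hK0 hκ hM.p_pos hN2 hM.le_F hM.le_Lam hM.Lam_le hM.ELam_le
      hL rfl hd hmax i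
  set X := F * Lamᵀ + E with hX
  have hgram : Fbarᵀ * Fbar = (p : ℝ)⁻¹ • Matrix.diagonal d := by
    rw [hFbar, Matrix.transpose_smul, Matrix.smul_mul, Matrix.mul_smul, gram_mul_loading hL hd,
      smul_smul (p : ℝ)⁻¹ (p : ℝ), inv_mul_cancel₀ hp0.ne', one_smul]
  have hlow : ∀ v : Fin r → ℝ, c * n * (v ⬝ᵥ v) ≤ (Fbar *ᵥ v) ⬝ᵥ (Fbar *ᵥ v) := by
    intro v
    rw [mulVec_dotProduct_self, hgram, Matrix.smul_mulVec, dotProduct_smul, smul_eq_mul,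
      le_inv_mul_iff₀ hp0, dotProduct, dotProduct, Finset.mul_sum, Finset.mul_sum]
    refine Finset.sum_le_sum fun i _ => ?_
    rw [Matrix.mulVec_diagonal]
    nlinarith [mul_le_mul_of_nonneg_right (hdlow i) (mul_self_nonneg (v i))]
  have hunit : IsUnit (Fbarᵀ * Fbar) := isUnit_gram_of_le_mulVec (by positivity) hlow
  have hSunit : IsUnit S := by
    have h1 : IsUnit (S * S) := by
      rw [hSS, Matrix.isUnit_iff_isUnit_det, Matrix.det_smul]
      exact (IsUnit.mk0 _ (by positivity)).mul ((Matrix.isUnit_iff_isUnit_det _).mp hunit)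
    rw [Matrix.isUnit_iff_isUnit_det, Matrix.det_mul] at h1
    exact (Matrix.isUnit_iff_isUnit_det _).mpr (isUnit_of_mul_isUnit_left h1)
  rw [projMat_mul_of_isUnit _ hSunit]
  have hLn : ‖L‖ ≤ K * √p := by
    have h1 : ‖L‖ ^ 2 = (√(r : ℝ) * √p) ^ 2 := by
      rw [mul_pow, Real.sq_sqrt (Nat.cast_nonneg r), Real.sq_sqrt hp0.le, norm_sq_eq_frobSq,
        frobSq_eq_sum_col]
      have h2 : ∀ i, Lᵀ i ⬝ᵥ Lᵀ i = p := fun i => by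
        have := congrFun (congrFun hL i) i
        simpa [Matrix.mul_apply, dotProduct] using this
      simp [h2]
    rw [(sq_eq_sq₀ (norm_nonneg _) (by positivity)).mp h1]
    have := hM.rank_le
    gcongr
  have hXn : ‖X‖ ≤ 2 * K ^ 2 * (√n * √p) := by
    calc ‖X‖ ≤ ‖F‖ * ‖Lamᵀ‖ + ‖E‖ :=
          (norm_add_le _ _).trans (by gcongr; exact Matrix.frobenius_norm_mul _ _)
      _ ≤ (K * √n) * (K * √p) + K * (√n * √p) := by
          rw [Matrix.frobenius_norm_transpose]
          have h1 := hM.F_le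
          have h2 := hM.Lam_le
          have h3 := hM.E_le
          gcongr
      _ = (K ^ 2 + K) * (√n * √p) := by ring
      _ ≤ _ := by gcongr; nlinarith
  have hFbarn : ‖Fbar‖ ≤ 2 * K ^ 3 * √n := by
    rw [hFbar, norm_smul, norm_inv, Real.norm_natCast, inv_mul_le_iff₀ hp0]
    calc ‖X * L‖ ≤ (2 * K ^ 2 * (√n * √p)) * (K * √p) :=
          (Matrix.frobenius_norm_mul _ _).trans (by gcongr)
      _ = (√(p : ℝ) * √p) * (2 * K ^ 3 * √n) := by ring
      _ = _ := by rw [hsp2]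
  set H : Matrix (Fin r) (Fin r) ℝ := (p : ℝ)⁻¹ • (Lamᵀ * L) with hH
  set R : Matrix (Fin n) (Fin r) ℝ := (p : ℝ)⁻¹ • (E * L) with hR
  have hdecomp : Fbar = F * H + R := by
    rw [hFbar, hH, hR, Matrix.mul_smul, ← smul_add, ← Matrix.mul_assoc, ← Matrix.add_mul]
  have hHn : ‖H‖ ≤ a := by
    refine le_trans ?_ haK2
    rw [hH, norm_smul, norm_inv, Real.norm_natCast, inv_mul_le_iff₀ hp0]
    calc ‖Lamᵀ * L‖ ≤ (K * √p) * (K * √p) := by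
          refine (Matrix.frobenius_norm_mul _ _).trans ?_
          rw [Matrix.frobenius_norm_transpose]
          have h2 := hM.Lam_le
          gcongr
      _ = (√(p : ℝ) * √p) * K ^ 2 := by ring
      _ = _ := by rw [hsp2]
  have hRn : ‖R‖ ≤ a := by
    refine le_trans ?_ ha2
    -- The eigenvector equation replaces `L D` by `Xᵀ X L = p Xᵀ Fbar`; then `Xᵀ` is split into its
    -- factor and idiosyncratic parts.
    have h1 : R * Matrix.diagonal d = E * Lam * (Fᵀ * Fbar) + E * Eᵀ * Fbar := by
      rw [hR, Matrix.smul_mul, Matrix.mul_assoc, ← hd, hFbar]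
      have h2 : Xᵀ = Lam * Fᵀ + Eᵀ := by
        rw [hX, Matrix.transpose_add, Matrix.transpose_mul, Matrix.transpose_transpose]
      conv_lhs => rw [Matrix.mul_assoc Xᵀ, h2]
      simp only [Matrix.mul_smul, Matrix.add_mul, Matrix.mul_add, smul_add, Matrix.mul_assoc]
    have h2 : ‖R * Matrix.diagonal d‖ ≤ 4 * K ^ 6 * (n * p) := by
      have g1 := hM.ELam_le
      have g2 := hM.F_le
      have g3 := hM.EE_le
      rw [h1]
      calc ‖E * Lam * (Fᵀ * Fbar) + E * Eᵀ * Fbar‖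
          ≤ ‖E * Lam‖ * (‖Fᵀ‖ * ‖Fbar‖) + ‖E * Eᵀ‖ * ‖Fbar‖ := by
            refine (norm_add_le _ _).trans (add_le_add ?_ (Matrix.frobenius_norm_mul _ _))
            refine (Matrix.frobenius_norm_mul _ _).trans ?_
            gcongr
            exact Matrix.frobenius_norm_mul _ _
        _ ≤ (K * (√n * √p)) * ((K * √n) * (2 * K ^ 3 * √n)) +
              (K * (√n * p)) * (2 * K ^ 3 * √n) := by
            rw [Matrix.frobenius_norm_transpose]; gcongr
        _ = 2 * K ^ 5 * (√n * √n) * √p * √n + 2 * K ^ 4 * (√n * √n) * p := by ring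
        -- This is where `p` must be at least of order `n`.
        _ ≤ 2 * K ^ 5 * (√n * √n) * √p * (K * √p) + 2 * K ^ 4 * (√n * √n) * p := by
            have := hM.n_le
            gcongr
        _ = 2 * K ^ 6 * (√n * √n) * (√p * √p) + 2 * K ^ 4 * (√n * √n) * p := by ring
        _ = 2 * K ^ 6 * (n * p) + 2 * K ^ 4 * (n * p) := by rw [hsn2, hsp2]; ring
        _ ≤ 2 * K ^ 6 * (n * p) + 2 * K ^ 6 * (n * p) := by
            gcongr
            norm_num
        _ = _ := by ring
    have h3 := mul_norm_le_norm_mul_diagonal R (by positivity) hdlow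
    rw [le_div_iff₀ hc0]
    refine le_of_mul_le_mul_right ?_ (mul_pos hn0 hp0)
    linarith
  have hinv : ‖(Fbarᵀ * Fbar)⁻¹‖ ≤ a / n := by
    refine le_trans ?_ (div_le_div_of_nonneg_right ha3 hn0.le)
    rw [hgram]
    exact norm_inv_smul_diagonal_le hc0 hn0 hp0 hdlow hM.rank_le
  have hFbarn' : ‖Fbar‖ ≤ a * √n := hFbarn.trans (by gcongr)
  have hsub := norm_sub_projMat_mul_le ha0 hc0 hN1 (hM.rank_le.trans haK) hdecomp hRn
    (hM.F_le.trans (by gcongr)) hFbarn' hinv hlow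
  have hPE := norm_projMat_mul_le (by linarith) hM.n_pos hdecomp hRn hHn hFbarn' hinv
    (hM.EJ_le.trans (by gcongr)) (hM.FEJ_le.trans (by gcongr))
  have hid : (1 - projMat Fbar) * (F * LamJᵀ + EJ) =
      EJ + ((F - projMat Fbar * F) * LamJᵀ - projMat Fbar * EJ) := by
    simp only [Matrix.sub_mul, Matrix.mul_add, Matrix.one_mul, Matrix.mul_assoc]
    abel
  rw [hid]
  refine norm_gram_add_sub_le (by linarith) hs hb0 hM.n_pos (hM.EJ_le.trans (by gcongr)) ?_
  calc ‖(F - projMat Fbar * F) * LamJᵀ - projMat Fbar * EJ‖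
      ≤ ‖F - projMat Fbar * F‖ * ‖LamJᵀ‖ + ‖projMat Fbar * EJ‖ :=
        (norm_sub_le _ _).trans (by gcongr; exact Matrix.frobenius_norm_mul _ _)
    _ ≤ 2 * a ^ 4 * √(4 * a ^ 4 / c) * (K * s) + 2 * a ^ 4 * s := by
        rw [Matrix.frobenius_norm_transpose]
        have := hM.LamJ_le
        gcongr
    _ = b * s := by rw [hb]; ring

/-! ### Bounds on means -/

section Mean

variable {Ω : Type*} [MeasurableSpace Ω] {P : Measure Ω}

lemma MeanLE.mono {Z : Ω → ℝ} {a b : ℝ} (h : MeanLE P Z a) (hab : a ≤ b) : MeanLE P Z b :=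
  ⟨h.1, h.2.trans hab⟩

lemma MeanLE.add {Z Y : Ω → ℝ} {a b : ℝ} (hZ : MeanLE P Z a) (hY : MeanLE P Y b) :
    MeanLE P (fun ω => Z ω + Y ω) (a + b) :=
  ⟨hZ.1.add hY.1, by rw [integral_add hZ.1 hY.1]; exact add_le_add hZ.2 hY.2⟩

lemma MeanLE.const_mul {Z : Ω → ℝ} {a c : ℝ} (hc : 0 ≤ c) (hZ : MeanLE P Z a) :
    MeanLE P (fun ω => c * Z ω) (c * a) :=
  ⟨hZ.1.const_mul c, by rw [integral_const_mul]; exact mul_le_mul_of_nonneg_left hZ.2 hc⟩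

lemma MeanLE.sum {ι : Type*} {s : Finset ι} {Z : ι → Ω → ℝ} {a : ι → ℝ}
    (h : ∀ i ∈ s, MeanLE P (Z i) (a i)) :
    MeanLE P (fun ω => ∑ i ∈ s, Z i ω) (∑ i ∈ s, a i) :=
  ⟨integrable_finsetSum _ fun i hi => (h i hi).1, by
    rw [integral_finsetSum _ fun i hi => (h i hi).1]
    exact Finset.sum_le_sum fun i hi => (h i hi).2⟩

lemma meanLE_const [IsProbabilityMeasure P] (c : ℝ) : MeanLE P (fun _ => c) c :=
  ⟨integrable_const c, by simp⟩

lemma MeanLE.of_le {Z Y : Ω → ℝ} {a : ℝ} (hZ : MeanLE P Z a) (hY : Measurable Y)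
    (h0 : ∀ ω, 0 ≤ Y ω) (h : ∀ ω, Y ω ≤ Z ω) : MeanLE P Y a := by
  have hi : Integrable Y P := hZ.1.mono' hY.aestronglyMeasurable
    (Eventually.of_forall fun ω => by rw [Real.norm_of_nonneg (h0 ω)]; exact h ω)
  exact ⟨hi, (integral_mono hi hZ.1 h).trans hZ.2⟩

lemma MeanLE.measure_ge_le [IsProbabilityMeasure P] {Z : Ω → ℝ} {a c : ℝ} (hZ : MeanLE P Z a)
    (h0 : ∀ ω, 0 ≤ Z ω) (hc : 0 < c) : P {ω | c ≤ Z ω} ≤ ENNReal.ofReal (a / c) := by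
  have h1 := mul_meas_ge_le_integral_of_nonneg (Eventually.of_forall h0) hZ.1 c
  have h2 : P.real {ω | c ≤ Z ω} ≤ a / c := by
    rw [le_div_iff₀ hc, mul_comm]
    exact h1.trans hZ.2
  rw [← ofReal_measureReal]
  exact ENNReal.ofReal_le_ofReal h2

end Mean

/-! ### Second moments of the idiosyncratic components -/

namespace FactorRegression

variable {Ω : Type*} [MeasurableSpace Ω] {P : Measure Ω} {r : ℕ}
  {D : FactorRegression Ω r} {M : ℝ}

lemma frobSq_transpose_F_mul_EJ (n : ℕ) (ω : Ω) :
    frobSq ((D.F n ω)ᵀ * selectCols (D.E n ω) (D.J n)) =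
      ∑ j ∈ D.J n, ‖∑ t, D.e n t j ω • D.f n t ω‖ ^ 2 := by
  rw [frobSq, Finset.sum_comm, ← Finset.sum_coe_sort (D.J n)]
  refine Finset.sum_congr rfl fun j _ => ?_
  rw [EuclideanSpace.norm_sq_eq]
  refine Finset.sum_congr rfl fun a _ => ?_
  rw [Real.norm_eq_abs, sq_abs, Matrix.mul_apply]
  simp [F, E, selectCols, mul_comm]

lemma meanLE_frobSq_F_EJ {G : (n : ℕ) → Matrix (D.J n) (D.J n) ℝ}
    (hC : D.AssumptionC P M G) (n : ℕ) (hn : 0 < n) :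
    MeanLE P (fun ω => frobSq ((D.F n ω)ᵀ * selectCols (D.E n ω) (D.J n)))
      (n * D.m n * M) := by
  have h := (hC.f_e_weak n).const_mul (c := n * D.m n) (by positivity)
  have hn' : (0 : ℝ) < n := by exact_mod_cast hn
  convert h using 2 with ω
  rw [frobSq_transpose_F_mul_EJ]
  rcases Nat.eq_zero_or_pos (D.m n) with hm | hm
  · have : D.J n = ∅ := Finset.card_eq_zero.mp hm
    simp [this]
  · have hm' : (0 : ℝ) < D.m n := by exact_mod_cast hm
    simp only [norm_smul, mul_pow, norm_inv, Real.norm_eq_abs, abs_of_nonneg (Real.sqrt_nonneg _),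
      inv_pow, Real.sq_sqrt hn'.le, ← Finset.mul_sum]
    field_simp

variable [IsProbabilityMeasure P]

lemma meanLE_e_sq (hB : D.AssumptionB P M) (n : ℕ) (t : Fin n) (i : Fin (D.p n)) :
    MeanLE P (fun ω => D.e n t i ω ^ 2) (1 + M) := by
  refine ((meanLE_const (P := P) 1).add (hB.e_moment n t i)).of_le
    ((D.measurable_e n t i).pow_const 2) (fun ω => sq_nonneg _) (fun ω => ?_)
  set x := |D.e n t i ω|
  rw [← sq_abs]
  change x ^ 2 ≤ 1 + x ^ 8
  nlinarith [sq_nonneg (x ^ 2 - 1), sq_nonneg (x ^ 4 - 1), sq_nonneg (x ^ 4 - x ^ 2)]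

lemma integrable_e_mul_e (hB : D.AssumptionB P M) (n : ℕ) (s t : Fin n) (i j : Fin (D.p n)) :
    Integrable (fun ω => D.e n s i ω * D.e n t j ω) P := by
  refine ((meanLE_e_sq hB n s i).1.add (meanLE_e_sq hB n t j).1).mono'
    ((D.measurable_e n s i).mul (D.measurable_e n t j)).aestronglyMeasurable
    (Eventually.of_forall fun ω => ?_)
  rw [Real.norm_eq_abs, Pi.add_apply, abs_le]
  constructor <;> nlinarith [sq_nonneg (D.e n s i ω - D.e n t j ω),
    sq_nonneg (D.e n s i ω + D.e n t j ω), sq_nonneg (D.e n s i ω), sq_nonneg (D.e n t j ω)]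

lemma meanLE_frobSq_E (hB : D.AssumptionB P M) (n : ℕ) :
    MeanLE P (fun ω => frobSq (D.E n ω)) (n * D.p n * (1 + M)) := by
  have h := MeanLE.sum (s := Finset.univ) fun t (_ : t ∈ Finset.univ) =>
    MeanLE.sum (s := Finset.univ) fun i (_ : i ∈ Finset.univ) => meanLE_e_sq hB n t i
  refine MeanLE.mono h (le_of_eq ?_)
  simp only [Finset.sum_const, Finset.card_univ, Fintype.card_fin, nsmul_eq_mul]
  ring

lemma meanLE_frobSq_EJ (hB : D.AssumptionB P M) (n : ℕ) :
    MeanLE P (fun ω => frobSq (selectCols (D.E n ω) (D.J n))) (n * D.m n * (1 + M)) := by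
  have h := MeanLE.sum (s := Finset.univ) fun t (_ : t ∈ Finset.univ) =>
    MeanLE.sum (s := Finset.univ) fun (i : D.J n) (_ : i ∈ Finset.univ) =>
      meanLE_e_sq hB n t i.1
  refine MeanLE.mono h (le_of_eq ?_)
  simp only [Finset.sum_const, Finset.card_univ, Fintype.card_fin, nsmul_eq_mul,
    Fintype.card_coe, m]
  ring

/-- Each squared entry expands into cross moments of idiosyncratic components in the same row, and
`e_cross` bounds their sum by order `p` instead of `p²`. -/
lemma meanLE_frobSq_E_Lam (hB : D.AssumptionB P M) {b : ℝ}
    (hb : ∀ n j, ‖D.lam n j‖ ≤ b) (n : ℕ) (hp : 0 < D.p n) :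
    MeanLE P (fun ω => frobSq (D.E n ω * D.Lam n)) (n * D.p n * (r * (b ^ 2 * M))) := by
  have hp' : (0 : ℝ) < D.p n := by exact_mod_cast hp
  obtain ⟨τ, hτ, hτM⟩ := hB.e_cross n
  have key : ∀ (t : Fin n) (a : Fin r),
      MeanLE P (fun ω => (D.E n ω * D.Lam n) t a ^ 2) (D.p n * (b ^ 2 * M)) := by
    intro t a
    have hfun : ∀ ω, (D.E n ω * D.Lam n) t a ^ 2 =
        ∑ i, ∑ j, D.lam n i a * D.lam n j a * (D.e n t i ω * D.e n t j ω) := by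
      intro ω
      rw [Matrix.mul_apply, sq, Finset.sum_mul_sum]
      refine Finset.sum_congr rfl fun i _ => Finset.sum_congr rfl fun j _ => ?_
      simp only [E, Lam, Matrix.of_apply]
      ring
    have h := MeanLE.sum (s := Finset.univ) fun i (_ : i ∈ Finset.univ) =>
      MeanLE.sum (s := Finset.univ)
        (Z := fun j ω => D.lam n i a * D.lam n j a * (D.e n t i ω * D.e n t j ω))
        (a := fun j => b ^ 2 * |τ i j|) (P := P)
        fun j (_ : j ∈ Finset.univ) =>
          ⟨(integrable_e_mul_e hB n t t i j).const_mul _, by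
            have ha : ∀ i, |D.lam n i a| ≤ b := fun i =>
              (PiLp.norm_apply_le (D.lam n i) a).trans (hb n i)
            have hb0 : 0 ≤ b := (abs_nonneg _).trans (ha i)
            rw [integral_const_mul]
            refine (le_abs_self _).trans ?_
            rw [abs_mul, abs_mul, sq]
            exact mul_le_mul (mul_le_mul (ha i) (ha j) (abs_nonneg _) hb0) (hτ t i j)
              (abs_nonneg _) (mul_nonneg hb0 hb0)⟩
    simp only [hfun]
    refine h.mono ?_
    simp only [← Finset.mul_sum]
    rw [inv_mul_le_iff₀ hp'] at hτM
    nlinarith [mul_le_mul_of_nonneg_left hτM (sq_nonneg b)]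
  have h := MeanLE.sum (s := Finset.univ) fun t (_ : t ∈ Finset.univ) =>
    MeanLE.sum (s := Finset.univ) fun a (_ : a ∈ Finset.univ) => key t a
  refine MeanLE.mono h (le_of_eq ?_)
  simp only [Finset.sum_const, Finset.card_univ, Fintype.card_fin, nsmul_eq_mul]
  ring

/-- The inequality `2 |x y| ≤ x² + y²` reduces the off-diagonal case to the diagonal one. -/
lemma abs_serial_le (hB : D.AssumptionB P M) (n : ℕ) (s t : Fin n) :
    |∫ ω, (D.p n : ℝ)⁻¹ * ∑ i, D.e n s i ω * D.e n t i ω ∂P| ≤ M := by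
  have hi : ∀ s t, Integrable (fun ω => (D.p n : ℝ)⁻¹ * ∑ i, D.e n s i ω * D.e n t i ω) P :=
    fun s t => (integrable_finsetSum _ fun i _ => integrable_e_mul_e hB n s t i i).const_mul _
  have h1 := (le_abs_self _).trans (hB.e_serial_diag n s)
  have h2 := (le_abs_self _).trans (hB.e_serial_diag n t)
  have h3 : ∫ ω, |(D.p n : ℝ)⁻¹ * ∑ i, D.e n s i ω * D.e n t i ω| ∂P ≤
      ∫ ω, (2⁻¹ * ((D.p n : ℝ)⁻¹ * ∑ i, D.e n s i ω * D.e n s i ω) +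
        2⁻¹ * ((D.p n : ℝ)⁻¹ * ∑ i, D.e n t i ω * D.e n t i ω)) ∂P := by
    refine integral_mono (hi s t).abs (((hi s s).const_mul _).add ((hi t t).const_mul _))
      fun ω => ?_
    simp only
    rw [abs_mul, abs_of_nonneg (by positivity : (0 : ℝ) ≤ (D.p n : ℝ)⁻¹)]
    have h4 : |∑ i, D.e n s i ω * D.e n t i ω| ≤
        ∑ i, (2⁻¹ * (D.e n s i ω * D.e n s i ω) + 2⁻¹ * (D.e n t i ω * D.e n t i ω)) := by
      refine (Finset.abs_sum_le_sum_abs _ _).trans (Finset.sum_le_sum fun i _ => ?_)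
      rw [abs_le]
      constructor <;> nlinarith [sq_nonneg (D.e n s i ω - D.e n t i ω),
        sq_nonneg (D.e n s i ω + D.e n t i ω)]
    rw [Finset.sum_add_distrib, ← Finset.mul_sum, ← Finset.mul_sum] at h4
    have := mul_le_mul_of_nonneg_left h4 (by positivity : (0 : ℝ) ≤ (D.p n : ℝ)⁻¹)
    linarith
  rw [integral_add ((hi s s).const_mul _) ((hi t t).const_mul _), integral_const_mul 2⁻¹,
    integral_const_mul 2⁻¹] at h3
  exact abs_integral_le_integral_abs.trans (by linarith)

/-- Each entry is a centred sum, of size `√p` by `e_fourth`, plus its mean `p γ(s,t)`. Since `γ² ≤ M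
|γ|`, the squared means are summed by the bound on `∑ |γ|`. -/
lemma meanLE_frobSq_E_ET (hB : D.AssumptionB P M) (hM : 0 ≤ M) (n : ℕ) (hp : 0 < D.p n)
    (hn : 0 < n) :
    MeanLE P (fun ω => frobSq (D.E n ω * (D.E n ω)ᵀ))
      (2 * (n : ℝ) ^ 2 * D.p n * (1 + M) + 2 * (D.p n : ℝ) ^ 2 * n * M ^ 2) := by
  have hp' : (0 : ℝ) < D.p n := by exact_mod_cast hp
  have hn' : (0 : ℝ) < n := by exact_mod_cast hn
  set γ : Fin n → Fin n → ℝ :=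
    fun s t => ∫ ω, (D.p n : ℝ)⁻¹ * ∑ i, D.e n s i ω * D.e n t i ω ∂P with hγ
  have key : ∀ s t, MeanLE P (fun ω => (D.E n ω * (D.E n ω)ᵀ) s t ^ 2)
      (2 * D.p n * (1 + M) + 2 * (D.p n : ℝ) ^ 2 * (M * |γ s t|)) := by
    intro s t
    have hΓ : ∑ i, ∫ ω, D.e n s i ω * D.e n t i ω ∂P = D.p n * γ s t := by
      rw [hγ]
      simp only
      rw [integral_const_mul, integral_finsetSum _ fun i _ => integrable_e_mul_e hB n s t i i,
        ← mul_assoc, mul_inv_cancel₀ hp'.ne', one_mul]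
    have h := (((meanLE_const (P := P) 1).add (hB.e_fourth n t s)).const_mul
      (c := 2 * D.p n) (by positivity)).add
      (meanLE_const (P := P) (2 * (D.p n : ℝ) ^ 2 * (M * |γ s t|)))
    have hfun : ∀ ω, (D.E n ω * (D.E n ω)ᵀ) s t = ∑ i, D.e n s i ω * D.e n t i ω := by
      intro ω
      simp [Matrix.mul_apply, E]
    simp only [hfun]
    refine h.of_le ?_ (fun ω => sq_nonneg _) fun ω => ?_
    · exact (Finset.measurable_sum _ fun i _ =>
        (D.measurable_e n s i).mul (D.measurable_e n t i)).pow_const 2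
    · rw [Finset.sum_sub_distrib, hΓ]
      set x := ∑ i, D.e n s i ω * D.e n t i ω
      set u := (√(D.p n : ℝ))⁻¹ * (x - D.p n * γ s t) with hu
      have hsp : √(D.p n : ℝ) ≠ 0 := (Real.sqrt_pos.mpr hp').ne'
      have hx : x = √(D.p n : ℝ) * u + D.p n * γ s t := by
        rw [hu, ← mul_assoc, mul_inv_cancel₀ hsp]; ring
      have h1 : (√(D.p n : ℝ) * u) ^ 2 = D.p n * u ^ 2 := by
        rw [mul_pow, Real.sq_sqrt hp'.le]
      have h2 : u ^ 2 ≤ 1 + |u| ^ 4 := by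
        have : |u| ^ 4 = (u ^ 2) ^ 2 := by rw [← sq_abs u]; ring
        rw [this]; nlinarith [sq_nonneg (u ^ 2 - 1), sq_nonneg u]
      have h3 : γ s t ^ 2 ≤ M * |γ s t| := by
        rw [← sq_abs, sq]
        exact mul_le_mul_of_nonneg_right (abs_serial_le hB n s t) (abs_nonneg _)
      have h4 : x ^ 2 ≤ 2 * (√(D.p n : ℝ) * u) ^ 2 + 2 * (D.p n * γ s t) ^ 2 := by
        rw [hx]; nlinarith [sq_nonneg (√(D.p n : ℝ) * u - D.p n * γ s t)]
      calc x ^ 2 ≤ 2 * D.p n * u ^ 2 + 2 * (D.p n : ℝ) ^ 2 * γ s t ^ 2 := by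
            rw [h1] at h4; linarith
        _ ≤ _ := by gcongr
  have h := MeanLE.sum (s := Finset.univ) fun s (_ : s ∈ Finset.univ) =>
    MeanLE.sum (s := Finset.univ) fun t (_ : t ∈ Finset.univ) => key s t
  refine MeanLE.mono h ?_
  have hs := hB.e_serial n
  rw [inv_mul_le_iff₀ hn'] at hs
  change ∑ s, ∑ t, |γ s t| ≤ n * M at hs
  simp only [Finset.sum_add_distrib, ← Finset.mul_sum, Finset.sum_const, Finset.card_univ,
    Fintype.card_fin, nsmul_eq_mul]
  have : M * ∑ s, ∑ t, |γ s t| ≤ M * (n * M) := mul_le_mul_of_nonneg_left hs hM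
  nlinarith [mul_le_mul_of_nonneg_left this (by positivity : 0 ≤ 2 * (D.p n : ℝ) ^ 2)]

end FactorRegression

/-! ### Perturbation of positive definite matrices -/

lemma Matrix.PosDef.exists_pos_le {ι : Type*} [Fintype ι] [DecidableEq ι] {S : Matrix ι ι ℝ}
    (hS : S.PosDef) : ∃ κ : ℝ, 0 < κ ∧ ∀ v : ι → ℝ, κ * (v ⬝ᵥ v) ≤ v ⬝ᵥ (S *ᵥ v) := by
  have hB : 0 < ‖S⁻¹‖ + 1 := by positivity
  refine ⟨(‖S⁻¹‖ + 1)⁻¹, by positivity, fun v => ?_⟩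
  -- The form of `S` is nonnegative at `v - t S⁻¹ v`. Expanding, and using `t (v ⬝ᵥ S⁻¹ v) ≤ v ⬝ᵥ
  -- v`, gives the bound with `κ = t`; the added 1 keeps `t` defined when `‖S⁻¹‖ = 0`.
  set t := (‖S⁻¹‖ + 1)⁻¹ with ht
  have hdet := (Matrix.isUnit_iff_isUnit_det S).mp hS.isUnit
  have hST : Sᵀ = S := by
    have := hS.isHermitian
    rwa [Matrix.IsHermitian, Matrix.conjTranspose_eq_transpose_of_trivial] at this
  set w := S⁻¹ *ᵥ v with hw
  have hSw : S *ᵥ w = v := by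
    rw [hw, Matrix.mulVec_mulVec, Matrix.mul_nonsing_inv _ hdet, Matrix.one_mulVec]
  have h1 := hS.posSemidef.dotProduct_mulVec_nonneg (v - t • w)
  have h2 : w ⬝ᵥ (S *ᵥ v) = v ⬝ᵥ v := by
    rw [Matrix.dotProduct_mulVec, ← Matrix.mulVec_transpose, hST, hSw]
  have h3 : v ⬝ᵥ w ≤ ‖S⁻¹‖ * (v ⬝ᵥ v) := (le_abs_self _).trans (dotProduct_mulVec_sq_le _ v)
  have h4 := dotProduct_self_nonneg' v
  rw [star_trivial, Matrix.mulVec_sub, Matrix.mulVec_smul, hSw, sub_dotProduct, dotProduct_sub,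
    dotProduct_sub, smul_dotProduct, smul_dotProduct, dotProduct_smul, dotProduct_smul, h2,
    dotProduct_comm w v] at h1
  simp only [smul_eq_mul] at h1
  have ht0 : 0 < t := by positivity
  have h5 : t * (v ⬝ᵥ w) ≤ v ⬝ᵥ v := by
    rw [ht, inv_mul_le_iff₀ hB]
    linarith
  nlinarith [mul_le_mul_of_nonneg_left h5 ht0.le]

lemma le_dotProduct_mulVec_of_norm_sub_le {ι : Type*} [Fintype ι] {A S : Matrix ι ι ℝ} {a b : ℝ}
    (hS : ∀ v : ι → ℝ, a * (v ⬝ᵥ v) ≤ v ⬝ᵥ (S *ᵥ v)) (h : ‖A - S‖ ≤ b) (v : ι → ℝ) :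
    (a - b) * (v ⬝ᵥ v) ≤ v ⬝ᵥ (A *ᵥ v) := by
  have h1 := (abs_le.mp (dotProduct_mulVec_sq_le (A - S) v)).1
  have h2 := mul_le_mul_of_nonneg_right h (dotProduct_self_nonneg' v)
  have h3 := hS v
  rw [Matrix.sub_mulVec, dotProduct_sub] at h1
  linarith

lemma abs_apply_le_norm {ι κ : Type*} [Fintype ι] [Fintype κ] (A : Matrix ι κ ℝ) (i : ι) (j : κ) :
    |A i j| ≤ ‖A‖ := by
  refine abs_le_of_sq_le_sq ?_ (norm_nonneg _)
  rw [norm_sq_eq_frobSq, frobSq]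
  exact (Finset.single_le_sum (f := fun j => A i j ^ 2) (fun _ _ => sq_nonneg _)
    (Finset.mem_univ j)).trans (Finset.single_le_sum (f := fun i => ∑ j, A i j ^ 2)
    (fun _ _ => Finset.sum_nonneg fun _ _ => sq_nonneg _) (Finset.mem_univ i))

/-- If the normalized Gram matrix of `F` is close to a positive definite matrix, then `F` is
bounded above and below. -/
lemma Matrix.PosDef.exists_gram_bounds {r : ℕ} {S : Matrix (Fin r) (Fin r) ℝ} (hS : S.PosDef) :
    ∃ κ B : ℝ, 0 < κ ∧ ∀ {n : ℕ} {F : Matrix (Fin n) (Fin r) ℝ}, 0 < n →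
      frob ((n : ℝ)⁻¹ • (Fᵀ * F) - S) < κ →
      (∀ v : Fin r → ℝ, n * κ * (v ⬝ᵥ v) ≤ v ⬝ᵥ ((Fᵀ * F) *ᵥ v)) ∧ ‖F‖ ≤ B * √n := by
  obtain ⟨κ, hκ, hSκ⟩ := hS.exists_pos_le
  refine ⟨κ / 2, √(r * (κ / 2 + ‖S‖)), by positivity, ?_⟩
  intro n F hn h
  have hn0 : (0 : ℝ) < n := by exact_mod_cast hn
  rw [frob_eq_norm] at h
  constructor
  · intro v
    have h1 := le_dotProduct_mulVec_of_norm_sub_le hSκ h.le v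
    rw [Matrix.smul_mulVec, dotProduct_smul, smul_eq_mul, le_inv_mul_iff₀ hn0] at h1
    linarith
  · rw [← Real.sqrt_mul (by positivity)]
    apply Real.le_sqrt_of_sq_le
    have h2 : ‖(n : ℝ)⁻¹ • (Fᵀ * F)‖ ≤ κ / 2 + ‖S‖ := by
      have := norm_add_le ((n : ℝ)⁻¹ • (Fᵀ * F) - S) S
      rw [sub_add_cancel] at this
      linarith
    have h3 : ∀ a, Fᵀ a ⬝ᵥ Fᵀ a ≤ (κ / 2 + ‖S‖) * n := by
      intro a
      have h4 := (le_abs_self _).trans ((abs_apply_le_norm _ a a).trans h2)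
      rw [Matrix.smul_apply, smul_eq_mul, inv_mul_le_iff₀ hn0, mul_comm (n : ℝ)] at h4
      simpa [Matrix.mul_apply, dotProduct] using h4
    rw [norm_sq_eq_frobSq, frobSq_eq_sum_col]
    refine (Finset.sum_le_sum fun a _ => h3 a).trans (le_of_eq ?_)
    simp [mul_assoc]

/-- A matrix close to one that is at least `c` is invertible, and its inverse is bounded. -/
lemma isUnit_and_specNorm_inv_le {ι : Type*} [Fintype ι] [DecidableEq ι] {A G : Matrix ι ι ℝ}
    {c : ℝ} (hc : 0 < c) (hG : (G - c • 1).PosSemidef) (h : frob (A - G) < c / 2) :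
    IsUnit A ∧ specNorm A⁻¹ ≤ 2 / c := by
  have hGc : ∀ v : ι → ℝ, c * (v ⬝ᵥ v) ≤ v ⬝ᵥ (G *ᵥ v) := by
    intro v
    have := hG.dotProduct_mulVec_nonneg v
    rw [star_trivial, Matrix.sub_mulVec, Matrix.smul_mulVec, Matrix.one_mulVec, dotProduct_sub,
      dotProduct_smul, smul_eq_mul] at this
    linarith
  rw [frob_eq_norm] at h
  have hA : ∀ v : ι → ℝ, (c / 2) ^ 2 * (v ⬝ᵥ v) ≤ (A *ᵥ v) ⬝ᵥ (A *ᵥ v) := by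
    intro v
    have h1 := le_dotProduct_mulVec_of_norm_sub_le hGc h.le v
    rw [show c - c / 2 = c / 2 by ring] at h1
    have h2 := dotProduct_sq_le v (A *ᵥ v)
    have h0 := dotProduct_self_nonneg' v
    rcases h0.eq_or_lt with h3 | h3
    · rw [← h3, mul_zero]; exact dotProduct_self_nonneg' _
    · have h4 : (c / 2 * (v ⬝ᵥ v)) ^ 2 ≤ (v ⬝ᵥ (A *ᵥ v)) ^ 2 := by gcongr
      refine le_of_mul_le_mul_left ?_ h3
      nlinarith
  have hunit := isUnit_of_le_mulVec (by positivity) hA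
  refine ⟨hunit, ?_⟩
  refine ContinuousLinearMap.opNorm_le_bound _ (by positivity) fun x => ?_
  refine (abs_le_of_sq_le_sq' ?_ (by positivity)).2
  have hx := hA (A⁻¹ *ᵥ x.ofLp)
  rw [Matrix.mulVec_mulVec, Matrix.mul_nonsing_inv _ ((Matrix.isUnit_iff_isUnit_det A).mp hunit),
    Matrix.one_mulVec] at hx
  have hnorm : ∀ y : EuclideanSpace ℝ ι, ‖y‖ ^ 2 = y.ofLp ⬝ᵥ y.ofLp := by
    intro y
    rw [EuclideanSpace.norm_sq_eq]
    simp [dotProduct, sq]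
  rw [mul_pow, hnorm, hnorm, Matrix.ofLp_toEuclideanCLM]
  calc _ = (2 / c) ^ 2 * ((c / 2) ^ 2 * ((A⁻¹ *ᵥ x.ofLp) ⬝ᵥ (A⁻¹ *ᵥ x.ofLp))) := by
        field_simp
    _ ≤ _ := by gcongr

/-! ### Consistency -/

namespace FactorRegression

variable {Ω : Type*} [MeasurableSpace Ω] {r : ℕ} {D : FactorRegression Ω r}

lemma X_eq (n : ℕ) (ω : Ω) : D.X n ω = D.F n ω * (D.Lam n)ᵀ + D.E n ω := by
  ext t j
  simp [X, F, Lam, E, Matrix.mul_apply, PiLp.inner_apply]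

lemma selectCols_X (n : ℕ) (ω : Ω) : selectCols (D.X n ω) (D.J n) =
    D.F n ω * ((D.Lam n).submatrix (Subtype.val : D.J n → Fin (D.p n)) id)ᵀ +
      selectCols (D.E n ω) (D.J n) := by
  rw [X_eq]
  ext t j
  simp [selectCols, Matrix.mul_apply]

/-- The size of the idiosyncratic components, relative to what is expected. -/
noncomputable def noise (D : FactorRegression Ω r) (n : ℕ) (ω : Ω) : ℝ :=
  ((n : ℝ) * D.p n)⁻¹ * frobSq (D.E n ω) +
  ((n : ℝ) * D.p n)⁻¹ * frobSq (D.E n ω * D.Lam n) +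
  ((n : ℝ) * (D.p n : ℝ) ^ 2)⁻¹ * frobSq (D.E n ω * (D.E n ω)ᵀ) +
  ((n : ℝ) * D.m n)⁻¹ * frobSq (selectCols (D.E n ω) (D.J n)) +
  ((n : ℝ) * D.m n)⁻¹ * frobSq ((D.F n ω)ᵀ * selectCols (D.E n ω) (D.J n))

lemma _root_.frobSq_nonneg {ι κ : Type*} [Fintype ι] [Fintype κ] (A : Matrix ι κ ℝ) :
    0 ≤ frobSq A := Finset.sum_nonneg fun _ _ => Finset.sum_nonneg fun _ _ => sq_nonneg _

lemma noise_nonneg (n : ℕ) (ω : Ω) : 0 ≤ D.noise n ω := by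
  have := frobSq_nonneg (D.E n ω)
  have := frobSq_nonneg (D.E n ω * D.Lam n)
  have := frobSq_nonneg (D.E n ω * (D.E n ω)ᵀ)
  have := frobSq_nonneg (selectCols (D.E n ω) (D.J n))
  have := frobSq_nonneg ((D.F n ω)ᵀ * selectCols (D.E n ω) (D.J n))
  unfold noise
  positivity

variable {P : Measure Ω} [IsProbabilityMeasure P] {M : ℝ}
  {G : (n : ℕ) → Matrix (D.J n) (D.J n) ℝ}

lemma exists_meanLE_noise (hA : D.AssumptionA M) (hB : D.AssumptionB P M)
    (hC : D.AssumptionC P M G) :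
    ∃ K : ℝ, 0 ≤ K ∧ ∀ᶠ n in atTop, MeanLE P (D.noise n) K := by
  obtain ⟨c, hc, hcp⟩ := hA.p_large
  obtain ⟨b, hb⟩ := hB.lam_bound
  -- `M` dominates a sum of absolute values, so it is nonnegative.
  have hM : 0 ≤ M := (Finset.sum_nonneg fun _ _ => abs_nonneg _).trans (hA.β_bound 0)
  refine ⟨(1 + M) + r * (b ^ 2 * M) + (2 * (1 + M) / c + 2 * M ^ 2) + (1 + M) + M, by positivity, ?_⟩
  filter_upwards [hcp, eventually_gt_atTop 0] with n hcn hn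
  have hn0 : (0 : ℝ) < n := by exact_mod_cast hn
  have hp0 : (0 : ℝ) < D.p n := lt_of_lt_of_le (by positivity) hcn
  have hp : 0 < D.p n := by exact_mod_cast hp0
  refine ((((?_ : MeanLE P _ _).add (?_ : MeanLE P _ _)).add (?_ : MeanLE P _ _)).add
    (?_ : MeanLE P _ _)).add (?_ : MeanLE P _ _)
  · refine ((meanLE_frobSq_E hB n).const_mul (by positivity)).mono (le_of_eq ?_)
    field_simp
  · refine ((meanLE_frobSq_E_Lam hB hb n hp).const_mul (by positivity)).mono (le_of_eq ?_)
    field_simp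
  · refine ((meanLE_frobSq_E_ET hB hM n hp hn).const_mul (by positivity)).mono ?_
    rw [inv_mul_le_iff₀ (by positivity)]
    have h1 : 2 * (n : ℝ) ^ 2 * D.p n * (1 + M) ≤
        n * (D.p n : ℝ) ^ 2 * (2 * (1 + M) / c) := by
      rw [mul_div_assoc', le_div_iff₀ hc]
      have := mul_le_mul_of_nonneg_left hcn
        (by positivity : 0 ≤ 2 * (n : ℝ) * D.p n * (1 + M))
      nlinarith
    nlinarith
  · refine ((meanLE_frobSq_EJ hB n).const_mul (by positivity)).mono ?_
    rw [← mul_assoc]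
    exact mul_le_of_le_one_left (by positivity) (inv_mul_le_one (a := (n : ℝ) * D.m n))
  · refine ((meanLE_frobSq_F_EJ hC n hn).const_mul (by positivity)).mono ?_
    rw [← mul_assoc]
    exact mul_le_of_le_one_left (by positivity) (inv_mul_le_one (a := (n : ℝ) * D.m n))

/-- Extracts a norm bound from one term of `noise`. If `a * b = 0`, the inverse is zero and `h`
carries no information; `hab` covers this case, which occurs for empty `J`. -/
lemma _root_.norm_le_of_inv_mul_frobSq_le {ι κ : Type*} [Fintype ι] [Fintype κ]
    {A : Matrix ι κ ℝ} {a b K k : ℝ} (ha : 0 ≤ a) (hb : 0 ≤ b) (hab : a * b = 0 → frobSq A = 0)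
    (h : (a * b)⁻¹ * frobSq A ≤ k) (hK : √k ≤ K) : ‖A‖ ≤ K * (√a * √b) := by
  have hK0 : 0 ≤ K := (Real.sqrt_nonneg _).trans hK
  rcases (mul_nonneg ha hb).eq_or_lt with h0 | h0
  · have h1 := hab h0.symm
    rw [← norm_sq_eq_frobSq] at h1
    rw [pow_eq_zero_iff (by norm_num)] at h1
    rw [h1]; positivity
  · rw [inv_mul_le_iff₀ h0, ← norm_sq_eq_frobSq] at h
    have hk : 0 ≤ k := by
      by_contra hk
      nlinarith [sq_nonneg ‖A‖, mul_pos h0 (neg_pos.mpr (not_le.mp hk))]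
    calc ‖A‖ ≤ √(a * b * k) := Real.le_sqrt_of_sq_le h
      _ = √k * (√a * √b) := by rw [Real.sqrt_mul h0.le, Real.sqrt_mul ha, mul_comm]
      _ ≤ _ := by gcongr

lemma norm_Lam_submatrix_le {b : ℝ} (hb : ∀ n j, ‖D.lam n j‖ ≤ b) (n : ℕ) :
    ‖(D.Lam n).submatrix (Subtype.val : D.J n → Fin (D.p n)) id‖ ≤ |b| * √(D.m n) := by
  refine (abs_le_of_sq_le_sq' ?_ (by positivity)).2
  rw [norm_sq_eq_frobSq, frobSq, mul_pow, Real.sq_sqrt (Nat.cast_nonneg _), sq_abs]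
  have h : ∀ j : D.J n, ∑ a, (D.Lam n).submatrix (Subtype.val : D.J n → Fin (D.p n)) id j a ^ 2 ≤
      b ^ 2 := by
    intro j
    have h1 : ‖D.lam n j‖ ^ 2 ≤ b ^ 2 := by
      have := hb n j
      gcongr
    rw [EuclideanSpace.norm_sq_eq] at h1
    simpa [Lam] using h1
  refine (Finset.sum_le_sum fun j _ => h j).trans (le_of_eq ?_)
  simp [m, mul_comm]

/-- On an event of probability near one all parts of the model have the expected size. -/
lemma exists_modelBounds (hA : D.AssumptionA M) (hB : D.AssumptionB P M)
    (hC : D.AssumptionC P M G) {η : ℝ} (hη : 0 < η) :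
    ∃ K κ : ℝ, 1 ≤ K ∧ 0 < κ ∧ ∀ᶠ n in atTop,
      P {ω | ¬ ModelBounds K κ √(D.m n) (D.F n ω) (D.Lam n) (D.E n ω)
        (selectCols (D.E n ω) (D.J n))
        ((D.Lam n).submatrix (Subtype.val : D.J n → Fin (D.p n)) id)} ≤ ENNReal.ofReal η := by
  obtain ⟨c, hc, hcp⟩ := hA.p_large
  obtain ⟨b, hb⟩ := hB.lam_bound
  obtain ⟨SF, hSF, hFconv⟩ := hB.f_cov
  obtain ⟨SL, hSL, hLconv⟩ := hB.lam_cov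
  obtain ⟨κ₁, B₁, hκ₁, hF⟩ := hSF.exists_gram_bounds
  obtain ⟨κ₂, B₂, hκ₂, hLam⟩ := hSL.exists_gram_bounds
  obtain ⟨K₀, hK₀, hnoise⟩ := exists_meanLE_noise hA hB hC
  -- Markov's threshold: a mean of at most `K₀` gives probability at most `η / 2`. The added 1 keeps
  -- `k` positive.
  set k := (K₀ + 1) / (η / 2) with hk
  have hk0 : 0 < k := by positivity
  obtain ⟨K, hK⟩ : ∃ K, K = 1 + √k + |B₁| + |B₂| + |b| + √(r : ℝ) + √(1 / c) := ⟨_, rfl⟩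
  have e1 := Real.sqrt_nonneg k
  have e2 := abs_nonneg B₁
  have e3 := abs_nonneg B₂
  have e4 := abs_nonneg b
  have e5 := Real.sqrt_nonneg (r : ℝ)
  have e6 := Real.sqrt_nonneg (1 / c)
  have e7 := le_abs_self B₁
  have e8 := le_abs_self B₂
  have hkK : √k ≤ K := by linarith
  refine ⟨K, min κ₁ κ₂, by linarith, lt_min hκ₁ hκ₂, ?_⟩
  have hF' := ENNReal.tendsto_nhds_zero.mp (hFconv κ₁ hκ₁) (ENNReal.ofReal (η / 2))
    (by simpa using hη)
  have hL' : ∀ᶠ n in atTop,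
      frob ((D.p n : ℝ)⁻¹ • ((D.Lam n)ᵀ * D.Lam n) - SL) < κ₂ := hLconv.eventually_lt_const hκ₂
  filter_upwards [hcp, hnoise, hF', hL', eventually_gt_atTop 0] with n hcn hZ hPF hL hn
  have hn0 : (0 : ℝ) < n := by exact_mod_cast hn
  have hp0 : (0 : ℝ) < D.p n := lt_of_lt_of_le (by positivity) hcn
  have hp : 0 < D.p n := by exact_mod_cast hp0
  have hPZ : P {ω | k ≤ D.noise n ω} ≤ ENNReal.ofReal (η / 2) := by
    refine (hZ.measure_ge_le (noise_nonneg n) hk0).trans (ENNReal.ofReal_le_ofReal ?_)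
    rw [hk, div_div_eq_mul_div, div_le_iff₀ (by positivity)]
    nlinarith
  have hsub : {ω | ¬ ModelBounds K (min κ₁ κ₂) √(D.m n) (D.F n ω) (D.Lam n) (D.E n ω)
      (selectCols (D.E n ω) (D.J n))
      ((D.Lam n).submatrix (Subtype.val : D.J n → Fin (D.p n)) id)} ⊆
      {ω | k ≤ D.noise n ω} ∪
        {ω | κ₁ ≤ frob ((n : ℝ)⁻¹ • ((D.F n ω)ᵀ * D.F n ω) - SF)} := by
    intro ω hω
    by_contra hcon
    apply hω
    simp only [Set.mem_union, Set.mem_ofPred_eq, not_or, not_le] at hcon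
    obtain ⟨hZk, hFk⟩ := hcon
    obtain ⟨hF1, hF2⟩ := hF hn hFk
    obtain ⟨hL1, hL2⟩ := hLam hp hL
    have z1 := mul_nonneg (by positivity : 0 ≤ ((n : ℝ) * D.p n)⁻¹) (frobSq_nonneg (D.E n ω))
    have z2 := mul_nonneg (by positivity : 0 ≤ ((n : ℝ) * D.p n)⁻¹)
      (frobSq_nonneg (D.E n ω * D.Lam n))
    have z3 := mul_nonneg (by positivity : 0 ≤ ((n : ℝ) * (D.p n : ℝ) ^ 2)⁻¹)
      (frobSq_nonneg (D.E n ω * (D.E n ω)ᵀ))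
    have z4 := mul_nonneg (by positivity : 0 ≤ ((n : ℝ) * D.m n)⁻¹)
      (frobSq_nonneg (selectCols (D.E n ω) (D.J n)))
    have z5 := mul_nonneg (by positivity : 0 ≤ ((n : ℝ) * D.m n)⁻¹)
      (frobSq_nonneg ((D.F n ω)ᵀ * selectCols (D.E n ω) (D.J n)))
    rw [noise] at hZk
    have hnp : (n : ℝ) * D.p n ≠ 0 := by positivity
    have hnp2 : (n : ℝ) * (D.p n : ℝ) ^ 2 ≠ 0 := by positivity
    have hJ : (n : ℝ) * D.m n = 0 → IsEmpty (D.J n) := by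
      intro h
      have h1 : D.m n = 0 := by
        rcases mul_eq_zero.mp h with h | h
        · exact absurd h hn0.ne'
        · exact_mod_cast h
      rw [Finset.card_eq_zero.mp h1]
      infer_instance
    refine ⟨hn, hp, by linarith, ?_, hF2.trans ?_, fun v => le_trans ?_ (hF1 v), hL2.trans ?_,
      fun v => le_trans ?_ (hL1 v), ?_, ?_, ?_, ?_, ?_, ?_⟩
    · have h1 : (n : ℝ) ≤ 1 / c * D.p n := by
        rw [div_mul_eq_mul_div, le_div_iff₀ hc]; linarith
      calc √(n : ℝ) ≤ √(1 / c * D.p n) := Real.sqrt_le_sqrt h1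
        _ = √(1 / c) * √(D.p n) := Real.sqrt_mul (by positivity) _
        _ ≤ _ := by gcongr; linarith
    · gcongr; linarith
    · have := dotProduct_self_nonneg' v
      gcongr; exact min_le_left _ _
    · gcongr; linarith
    · have := dotProduct_self_nonneg' v
      gcongr; exact min_le_right _ _
    · exact norm_le_of_inv_mul_frobSq_le hn0.le hp0.le (fun h => absurd h hnp)
        (by linarith) hkK
    · exact norm_le_of_inv_mul_frobSq_le hn0.le hp0.le (fun h => absurd h hnp)
        (by linarith) hkK
    · have := norm_le_of_inv_mul_frobSq_le (A := D.E n ω * (D.E n ω)ᵀ) (k := k) hn0.le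
        (sq_nonneg (D.p n : ℝ)) (fun h => absurd h hnp2) (by linarith) hkK
      rwa [Real.sqrt_sq hp0.le] at this
    · refine norm_le_of_inv_mul_frobSq_le hn0.le (Nat.cast_nonneg _) (fun h => ?_)
        (by linarith) hkK
      have := hJ h
      simp [frobSq]
    · refine norm_le_of_inv_mul_frobSq_le hn0.le (Nat.cast_nonneg _) (fun h => ?_)
        (by linarith) hkK
      have := hJ h
      simp [frobSq]
    · refine (norm_Lam_submatrix_le hb n).trans ?_
      gcongr; linarith
  calc _ ≤ P ({ω | k ≤ D.noise n ω} ∪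
        {ω | κ₁ ≤ frob ((n : ℝ)⁻¹ • ((D.F n ω)ᵀ * D.F n ω) - SF)}) := measure_mono hsub
    _ ≤ ENNReal.ofReal (η / 2) + ENNReal.ofReal (η / 2) :=
        (measure_union_le _ _).trans (add_le_add hPZ hPF)
    _ = ENNReal.ofReal η := by
        rw [← ENNReal.ofReal_add (by positivity) (by positivity), add_halves]

/-- The Gram matrix of the selected predictors, projected off the estimated factors, is a consistent
estimate of the covariance of the selected idiosyncratic components. -/
theorem tendsto_projectedGram (hA : D.AssumptionA M) (hB : D.AssumptionB P M)
    (hC : D.AssumptionC P M G) {Fhat : (n : ℕ) → Ω → Matrix (Fin n) (Fin r) ℝ}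
    (hF : ∀ᶠ n in atTop, ∀ ω, IsFactorEstimate (D.X n ω) (Fhat n ω)) {δ : ℝ} (hδ : 0 < δ) :
    Tendsto (fun n : ℕ =>
      P {ω | δ ≤ frob (projectedGram (D.X n ω) (D.J n) (Fhat n ω) - G n)}) atTop (𝓝 0) := by
  rw [ENNReal.tendsto_nhds_zero]
  intro ε hε
  obtain ⟨η, hη, hηε⟩ : ∃ η : ℝ, 0 < η ∧ ENNReal.ofReal η ≤ ε := by
    rcases eq_or_ne ε ⊤ with h | h
    · exact ⟨1, one_pos, by simp [h]⟩
    · exact ⟨ε.toReal, ENNReal.toReal_pos hε.ne' h, by rw [ENNReal.ofReal_toReal h]⟩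
  obtain ⟨K, κ, hK, hκ, hbad⟩ := exists_modelBounds hA hB hC (half_pos hη)
  obtain ⟨C, N, hCN⟩ := norm_projected_gram_sub_le hK hκ
  have hcov := ENNReal.tendsto_nhds_zero.mp (hC.e_cov (δ / 2) (half_pos hδ))
    (ENNReal.ofReal (η / 2)) (by simpa using hη)
  -- The rate `m / √n` is the square root of `m² / n`.
  have hrate : Tendsto (fun n : ℕ => C * (√(D.m n) ^ 2 / √n)) atTop (𝓝 0) := by
    have h1 := (Real.continuous_sqrt.tendsto 0).comp hA.m_small
    rw [Real.sqrt_zero] at h1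
    have h2 := h1.const_mul C
    rw [mul_zero] at h2
    refine h2.congr fun n => ?_
    simp only [Function.comp_apply]
    rw [Real.sqrt_div (sq_nonneg _), Real.sqrt_sq (Nat.cast_nonneg _),
      Real.sq_sqrt (Nat.cast_nonneg _)]
  filter_upwards [hbad, hcov, hF, hrate.eventually_lt_const (half_pos hδ),
    tendsto_natCast_atTop_atTop.eventually_ge_atTop N] with n h1 h2 h3 h4 h5
  refine le_trans ?_ hηε
  have hsub : {ω | δ ≤ frob (projectedGram (D.X n ω) (D.J n) (Fhat n ω) - G n)} ⊆
      {ω | ¬ ModelBounds K κ √(D.m n) (D.F n ω) (D.Lam n) (D.E n ω)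
        (selectCols (D.E n ω) (D.J n))
        ((D.Lam n).submatrix (Subtype.val : D.J n → Fin (D.p n)) id)} ∪
      {ω | δ / 2 ≤ frob ((n : ℝ)⁻¹ • ((selectCols (D.E n ω) (D.J n))ᵀ *
        selectCols (D.E n ω) (D.J n)) - G n)} := by
    intro ω hω
    by_contra hcon
    simp only [Set.mem_union, Set.mem_ofPred_eq, not_or, not_le, not_not] at hcon
    obtain ⟨hM, hG⟩ := hcon
    have h6 := h3 ω
    rw [X_eq] at h6
    have h7 := hCN (Real.sqrt_nonneg _) hM h5 h6
    rw [← selectCols_X] at h7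
    change ‖projectedGram (D.X n ω) (D.J n) (Fhat n ω) - _‖ ≤ _ at h7
    rw [Set.mem_ofPred_eq, frob_eq_norm] at hω
    rw [frob_eq_norm] at hG
    have h8 := norm_sub_le_norm_sub_add_norm_sub (projectedGram (D.X n ω) (D.J n) (Fhat n ω))
      ((n : ℝ)⁻¹ • ((selectCols (D.E n ω) (D.J n))ᵀ * selectCols (D.E n ω) (D.J n))) (G n)
    linarith
  calc _ ≤ _ := measure_mono hsub
    _ ≤ ENNReal.ofReal (η / 2) + ENNReal.ofReal (η / 2) :=
        (measure_union_le _ _).trans (add_le_add h1 h2)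
    _ = ENNReal.ofReal η := by
        rw [← ENNReal.ofReal_add (by positivity) (by positivity), add_halves]

end FactorRegression

end

/-! ### The theorem for the correct and for the selected rank -/

theorem theorem3 {Ω : Type*} [MeasurableSpace Ω] (P : Measure Ω) [IsProbabilityMeasure P]
    (r kmax : ℕ) (hr : r ∈ Finset.Icc 1 kmax)
    (D : FactorRegression Ω r) (M : ℝ) (G : (n : ℕ) → Matrix (D.J n) (D.J n) ℝ)
    (hA : D.AssumptionA M) (hB : D.AssumptionB P M) (hC : D.AssumptionC P M G)
    (Fhat : (n : ℕ) → Ω → (k : ℕ) → Matrix (Fin n) (Fin k) ℝ)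
    (hF : ∀ᶠ n in atTop, ∀ ω, ∀ k ∈ Finset.Icc 1 kmax,
      IsFactorEstimate (D.X n ω) (Fhat n ω k))
    (khat : ℕ → Ω → ℕ)
    (hk : ∀ᶠ n in atTop, ∀ ω, IsSelectedRank (D.X n ω) kmax (Fhat n ω) (khat n ω)) :
    -- the estimate with `r` factors
    ((∀ δ : ℝ, 0 < δ → Tendsto (fun n : ℕ =>
        P {ω | δ ≤ frob (projectedGram (D.X n ω) (D.J n) (Fhat n ω r) - G n)}) atTop (𝓝 0)) ∧
      (∀ c : ℝ, 0 < c → (∀ᶠ n in atTop, (G n - c • 1).PosSemidef) →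
        Tendsto (fun n : ℕ =>
          P {ω | ¬ IsUnit (projectedGram (D.X n ω) (D.J n) (Fhat n ω r))}) atTop (𝓝 0) ∧
        ∀ η : ℝ, 0 < η → ∃ C : ℝ, ∀ᶠ n in atTop,
          P {ω | C < specNorm (projectedGram (D.X n ω) (D.J n) (Fhat n ω r))⁻¹}
            ≤ ENNReal.ofReal η)) ∧
    -- the estimate with the selected number of factors, on the event that this number is `r`
    ((∀ δ : ℝ, 0 < δ → Tendsto (fun n : ℕ =>
        P {ω | khat n ω = r ∧
          δ ≤ frob (projectedGram (D.X n ω) (D.J n) (Fhat n ω (khat n ω)) - G n)})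
        atTop (𝓝 0)) ∧
      (∀ c : ℝ, 0 < c → (∀ᶠ n in atTop, (G n - c • 1).PosSemidef) →
        Tendsto (fun n : ℕ =>
          P {ω | khat n ω = r ∧
            ¬ IsUnit (projectedGram (D.X n ω) (D.J n) (Fhat n ω (khat n ω)))}) atTop (𝓝 0) ∧
        ∀ η : ℝ, 0 < η → ∃ C : ℝ, ∀ᶠ n in atTop,
          P {ω | khat n ω = r ∧
            C < specNorm (projectedGram (D.X n ω) (D.J n) (Fhat n ω (khat n ω)))⁻¹}
            ≤ ENNReal.ofReal η)) := by
  have hest : ∀ᶠ n in atTop, ∀ ω, IsFactorEstimate (D.X n ω) (Fhat n ω r) :=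
    hF.mono fun n h ω => h ω r hr
  have hconv : ∀ δ : ℝ, 0 < δ → Tendsto (fun n : ℕ =>
      P {ω | δ ≤ frob (projectedGram (D.X n ω) (D.J n) (Fhat n ω r) - G n)}) atTop (𝓝 0) :=
    fun δ hδ => FactorRegression.tendsto_projectedGram hA hB hC hest hδ
  have hsing : ∀ c : ℝ, 0 < c → (∀ᶠ n in atTop, (G n - c • 1).PosSemidef) →
      Tendsto (fun n : ℕ =>
        P {ω | ¬ IsUnit (projectedGram (D.X n ω) (D.J n) (Fhat n ω r))}) atTop (𝓝 0) := by
    intro c hc hG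
    refine tendsto_of_tendsto_of_tendsto_of_le_of_le' tendsto_const_nhds
      (hconv (c / 2) (half_pos hc)) (Eventually.of_forall fun _ => zero_le) ?_
    filter_upwards [hG] with n hGn
    refine measure_mono fun ω hω => ?_
    by_contra h
    exact hω (isUnit_and_specNorm_inv_le hc hGn (not_le.mp h)).1
  have hinv : ∀ c : ℝ, 0 < c → (∀ᶠ n in atTop, (G n - c • 1).PosSemidef) →
      ∀ η : ℝ, 0 < η → ∃ C : ℝ, ∀ᶠ n in atTop,
        P {ω | C < specNorm (projectedGram (D.X n ω) (D.J n) (Fhat n ω r))⁻¹}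
          ≤ ENNReal.ofReal η := by
    intro c hc hG η hη
    refine ⟨2 / c, ?_⟩
    filter_upwards [hG, ENNReal.tendsto_nhds_zero.mp (hconv (c / 2) (half_pos hc))
      (ENNReal.ofReal η) (by simpa using hη)] with n hGn hn
    refine (measure_mono fun ω hω => ?_).trans hn
    by_contra h
    exact absurd (isUnit_and_specNorm_inv_le hc hGn (not_le.mp h)).2 (not_le.mpr hω)
  refine ⟨⟨hconv, fun c hc hG => ⟨hsing c hc hG, hinv c hc hG⟩⟩, fun δ hδ => ?_,
    fun c hc hG => ⟨?_, fun η hη => ?_⟩⟩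
  -- The event is contained in the corresponding one for rank `r`. Monotonicity of `P` needs no
  -- measurability, so any choice of eigenvectors is allowed.
  · refine tendsto_of_tendsto_of_tendsto_of_le_of_le tendsto_const_nhds (hconv δ hδ)
      (fun _ => zero_le) fun n => measure_mono ?_
    rintro ω ⟨h1, h2⟩
    rw [h1] at h2
    exact h2
  · refine tendsto_of_tendsto_of_tendsto_of_le_of_le tendsto_const_nhds (hsing c hc hG)
      (fun _ => zero_le) fun n => measure_mono ?_
    rintro ω ⟨h1, h2⟩
    rw [h1] at h2
    exact h2
  · obtain ⟨C, hCn⟩ := hinv c hc hG η hη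
    refine ⟨C, hCn.mono fun n hn => (measure_mono ?_).trans hn⟩
    rintro ω ⟨h1, h2⟩
    rw [h1] at h2
    exact h2
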